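/- Let $\mathbb S^1=\{|z|=1\}$, $\pi(x)=e^{2\pi i x}$, and let $m\ge 2$ be an integer. A degree $m$ circle endomorphism is an orientation preserving covering $f:\mathbb S^1\to\mathbb S^1$ of degree $m$; it lifts to an increasing homeomorphism $F$ of $\mathbb R$ with $\pi\circ F=f\circ\pi$ and $F(x+1)=F(x)+m$. It is called uniformly asymptotically affine (UAA) if there is a bounded positive function $\varepsilon$ on $(0,\infty)$ with $\varepsilon(y)\to0$ as $y\to0^+$ such that $$\frac1{1+\varepsilon(y)}\le\frac{F^{-n}(x+y)-F^{-n}(x)}{F^{-n}(x)-F^{-n}(x-y)}\le 1+\varepsilon(y)\qquad\text{for all } n\ge1,\ x\in\mathbb R,\ y>0 .$$ A uniformly asymptotically conformal (UAC) system of degree $m$ is a map $\tilde f:\{r<|z|<1/r\}\to\mathbb C\setminus\{0\}$, for some $0<r<1$, which extends a degree $m$ circle endomorphism, is locally a quasiconformal homeomorphism, satisfies $\tilde f(1/\bar z)=1/\overline{\tilde f(z)}$, and whose inverse iterates satisfy the following: there is an annulus $\{s<|z|<1/s\}$, $r\le s<1$, each point of which has for every $n\ge1$ exactly $m^n$ preimages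 under $\tilde f^{\,n}$ (orbits being required to stay in $\{r<|z|<1/r\}$ at the times $0,\dots,n-1$); and for every $\varepsilon>0$ there is an annulus $U=\{s'<|z|<1/s'\}$, $r\le s'<1$, such that for every $n\ge1$ every branch of $\tilde f^{-n}$ on a disc in $U$ is quasiconformal and its dilatation satisfies $K_z(\tilde f^{-n})<1+\varepsilon$ at almost every point $z$ of the disc. Theorem. For every UAA circle endomorphism $f$ of degree $m\ge2$ there exists a UAC system $\tilde f$ of degree $m$, defined on an annular neighborhood of $\mathbb S^1$, such that $\tilde f|_{\mathbb S^1}=f$. -/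

import Mathlib

open MeasureTheory Topology
open scoped ContDiff

noncomputable section

namespace CircleEndo

/-! ### Circle endomorphisms and uniform asymptotic affinity -/

/-- The universal covering `x ↦ exp (2 π i x)` of the unit circle by the real line. -/
def covering (x : ℝ) : Circle := Circle.exp (2 * Real.pi * x)

/-- `F` is a lift of the circle map `f` witnessing that `f` is an orientation preserving covering
of the circle of degree `m`: it is an increasing homeomorphism of the line with `F (x + 1) = F x + m`
that covers `f`. -/
structure IsLift (m : ℕ) (f : Circle → Circle) (F : ℝ ≃ₜ ℝ) : Prop where
  strictMono : StrictMono F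
  semiconj : ∀ x : ℝ, covering (F x) = f (covering x)
  map_add_one : ∀ x : ℝ, F (x + 1) = F x + m

/-- Circle endomorphisms of degree `m`: orientation preserving coverings of degree `m`. -/
def IsCircleEndomorphism (m : ℕ) (f : Circle → Circle) : Prop :=
  ∃ F : ℝ ≃ₜ ℝ, IsLift m f F

/-- The quasisymmetric distortion function of `H`. -/
def rho (H : ℝ → ℝ) (x y : ℝ) : ℝ := (H (x + y) - H x) / (H x - H (x - y))

/-- A vanishing function: a bounded positive function on `(0, ∞)` which tends to `0` at `0`. -/
structure IsVanishing (ε : ℝ → ℝ) : Prop where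
  pos : ∀ y : ℝ, 0 < y → 0 < ε y
  bounded : ∃ C : ℝ, ∀ y : ℝ, 0 < y → ε y ≤ C
  tendsto : Filter.Tendsto ε (𝓝[>] 0) (𝓝 0)

/-- `f` is a uniformly asymptotically affine circle endomorphism of degree `m`. Two lifts of `f`
differ by an integer constant, so that their inverse iterates differ by translations of the variable
and have the same bounds: the condition does not depend on the lift. -/
def IsUAA (m : ℕ) (f : Circle → Circle) : Prop :=
  ∃ F : ℝ ≃ₜ ℝ, IsLift m f F ∧ ∃ ε : ℝ → ℝ, IsVanishing ε ∧
    ∀ n : ℕ, 1 ≤ n → ∀ x y : ℝ, 0 < y →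
      1 / (1 + ε y) ≤ rho (F.symm^[n]) x y ∧ rho (F.symm^[n]) x y ≤ 1 + ε y

/-! ### Quasiconformal maps of plane domains and their dilatation -/

/-- On the open set `Ω`, the locally integrable function `d` is the distributional derivative of `G`
in the direction `v`. -/
def HasWeakDirDeriv (Ω : Set ℂ) (G : ℂ → ℂ) (v : ℂ) (d : ℂ → ℂ) : Prop :=
  LocallyIntegrableOn G Ω ∧ LocallyIntegrableOn d Ω ∧
    ∀ φ : ℂ → ℝ, ContDiff ℝ ∞ φ → HasCompactSupport φ → tsupport φ ⊆ Ω →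
      ∫ z in Ω, (fderiv ℝ φ z v) • G z = - ∫ z in Ω, φ z • d z

/-- On the open set `Ω`, the distributional derivatives `G_z` and `G_{\bar z}` are the locally
integrable functions `p` and `q`, that is, `G_x = p + q` and `G_y = i (p - q)`. -/
def HasWeakWirtinger (Ω : Set ℂ) (G p q : ℂ → ℂ) : Prop :=
  HasWeakDirDeriv Ω G 1 (fun z => p z + q z) ∧
    HasWeakDirDeriv Ω G Complex.I (fun z => Complex.I * (p z - q z))

/-- `G` is a quasiconformal homeomorphism of the plane domain `Ω` onto a plane domain. Preservation
of orientation is expressed by `G_z ≠ 0` almost everywhere: together with the inequality it says that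
the Jacobian `|G_z| ^ 2 - |G_{\bar z}| ^ 2` is positive almost everywhere. -/
structure IsQuasiconformalOn (Ω : Set ℂ) (G : ℂ → ℂ) : Prop where
  isOpen : IsOpen Ω
  isConnected : IsConnected Ω
  isOpenEmbedding : IsOpenEmbedding (fun z : Ω => G z)
  beltrami : ∃ p q : ℂ → ℂ, HasWeakWirtinger Ω G p q ∧ ∃ k : ℝ, 0 ≤ k ∧ k < 1 ∧
    ∀ᵐ z ∂(volume.restrict Ω), p z ≠ 0 ∧ ‖q z‖ ≤ k * ‖p z‖

/-- The dilatation `K_z(G)` of `G` satisfies `K_z(G) < c` for almost every `z` in `Ω`. -/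
def DilatationLT (Ω : Set ℂ) (G : ℂ → ℂ) (c : ℝ) : Prop :=
  ∃ p q : ℂ → ℂ, HasWeakWirtinger Ω G p q ∧
    ∀ᵐ z ∂(volume.restrict Ω), ‖q z‖ < ‖p z‖ ∧ (‖p z‖ + ‖q z‖) / (‖p z‖ - ‖q z‖) < c

/-! ### Uniform asymptotic conformality -/

/-- The annulus `r < |z| < 1 / r`. -/
def annulus (r : ℝ) : Set ℂ := {z | r < ‖z‖ ∧ ‖z‖ < 1 / r}

/-- The domain of the `n`-th iterate of a map `g` defined on `A`. -/
def iterDomain (A : Set ℂ) (g : ℂ → ℂ) (n : ℕ) : Set ℂ := {z | ∀ k < n, g^[k] z ∈ A}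

/-- `h` is a branch on `V` of the inverse of the `n`-th iterate of the map `g` defined on `A`. -/
structure IsInverseBranch (A : Set ℂ) (g : ℂ → ℂ) (n : ℕ) (V : Set ℂ) (h : ℂ → ℂ) : Prop where
  continuousOn : ContinuousOn h V
  mem_iterDomain : ∀ w ∈ V, h w ∈ iterDomain A g n
  iterate_eq : ∀ w ∈ V, g^[n] (h w) = w

/-- `g`, defined on the annulus `r < |z| < 1 / r`, is a uniformly asymptotically conformal system of
degree `m`. -/
structure IsUAC (m : ℕ) (r : ℝ) (g : ℂ → ℂ) : Prop where
  r_pos : 0 < r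
  r_lt_one : r < 1
  /-- `g` extends a circle endomorphism of degree `m`. -/
  extends_circle : ∃ f : Circle → Circle, IsCircleEndomorphism m f ∧ ∀ z : Circle, g z = f z
  /-- `g` is invariant under the reflection in the circle. -/
  ne_zero : ∀ z ∈ annulus r, g z ≠ 0
  reflection : ∀ z ∈ annulus r,
    g (1 / (starRingEnd ℂ) z) = 1 / (starRingEnd ℂ) (g z)
  /-- `g` is locally a quasiconformal homeomorphism. -/
  locally_quasiconformal : ∀ z ∈ annulus r, ∃ V : Set ℂ, z ∈ V ∧ V ⊆ annulus r ∧
    IsQuasiconformalOn V g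
  /-- All the inverse iterates of `g` are defined on a common annulus, where the inverse of the
  `n`-th iterate has exactly `m ^ n` values. -/
  fibres : ∃ s : ℝ, r ≤ s ∧ s < 1 ∧ ∀ n : ℕ, 1 ≤ n → ∀ w ∈ annulus s,
    {z | z ∈ iterDomain (annulus r) g n ∧ g^[n] z = w}.ncard = m ^ n
  /-- The dilatation of all the inverse iterates is close to one near the circle, uniformly in the
  number of iterations. As the dilatation is a local notion, the branches are taken over discs. -/
  asymptotically_conformal : ∀ ε : ℝ, 0 < ε → ∃ s : ℝ, r ≤ s ∧ s < 1 ∧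
    ∀ n : ℕ, 1 ≤ n → ∀ (c : ℂ) (δ : ℝ), 0 < δ → Metric.ball c δ ⊆ annulus s →
      ∀ h : ℂ → ℂ, IsInverseBranch (annulus r) g n (Metric.ball c δ) h →
        IsQuasiconformalOn (Metric.ball c δ) h ∧ DilatationLT (Metric.ball c δ) h (1 + ε)

end CircleEndo

end

/-! The proof makes every inverse iterate linear in one and the same coordinate. The UAA condition
bounds the distortion of all `F.symm^[n]` by a common constant M, so the maps x ↦ F⁻ⁿ(mⁿ x) converge
to a homeomorphism G of the line which is quasisymmetric, commutes with the unit translation and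
satisfies G(m x) = F(G x) (`IsLift.exists_semiconj`). Let Φ be the Beurling–Ahlfors extension of G
to the plane. Then Φ ∘ (m ·) ∘ Φ⁻¹ extends F and descends under z ↦ exp(2πiz) to the required
system; the branches of its n-th inverse are covered by Φ ∘ (m⁻ⁿ ·) ∘ Φ⁻¹.

Asymptotic conformality rests on two features of the extension: it commutes with real scaling, and
its derivative at x + iy is linear in G, kills constants and sees G only on [x - |y|, x + |y|]. By
scaling, Φ(m⁻ⁿ z) is the extension of G(m⁻ⁿ ·) = F⁻ⁿ ∘ G. At small scales F⁻ⁿ is almost affine,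
uniformly in n (`QuasisymmetricBelow.abs_sub_affine_le`), so the derivative of the extension of F⁻ⁿ
∘ G is almost a positive real multiple b of the derivative of Φ. The error is a small relative one
because quasisymmetry of G bounds the derivative of Φ from below (`le_norm_beurlingAhlforsDeriv`).
Composing with Φ⁻¹ gives a derivative close to multiplication by b, with an error that does not
depend on n (`exists_asymptoticallyConformal`).

To pass from pointwise derivatives to quasiconformality, note that the derivatives exist off the
unit circle, a closed null set which meets horizontal and vertical lines in countable sets. Fubini
and the fundamental theorem of calculus then identify them with the distributional derivatives, and
the area formula makes them locally integrable (`isQuasiconformalOn_and_dilatationLT`). -/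

noncomputable section

namespace CircleEndo

/-! ### Quasisymmetric functions of the line -/

/-- At all scales less than `d`, the function `K` is quasisymmetric with constant `M`. -/
def QuasisymmetricBelow (d M : ℝ) (K : ℝ → ℝ) : Prop :=
  ∀ x y : ℝ, 0 < y → y < d →
    K (x + y) - K x ≤ M * (K x - K (x - y)) ∧ K x - K (x - y) ≤ M * (K (x + y) - K x)

/-- The function `K` is quasisymmetric with constant `M`. -/
def Quasisymmetric (M : ℝ) (K : ℝ → ℝ) : Prop :=
  ∀ x y : ℝ, 0 < y →
    K (x + y) - K x ≤ M * (K x - K (x - y)) ∧ K x - K (x - y) ≤ M * (K (x + y) - K x)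

/-- Bisection. Since 1 + e ≤ 2, each half of an interval carries at most 2/3 of the increment, and
the midpoint value misses the average by at most e/2 of it. The relative error therefore obeys E ↦
2E/3 + e, whose fixed point is 3e; the term (2/3)^N is what remains of the trivial initial bound. -/
theorem QuasisymmetricBelow.abs_sub_affine_le_aux {K : ℝ → ℝ} (hK : Monotone K) {e d : ℝ}
    (he0 : 0 ≤ e) (he : e ≤ 1) (h : QuasisymmetricBelow d (1 + e) K) (N : ℕ) :
    ∀ p l t : ℝ, 0 < l → l < d → 0 ≤ t → t ≤ 1 →
      |K (p + t * l) - (K p + t * (K (p + l) - K p))| ≤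
        (3 * e + (2 / 3) ^ N) * (K (p + l) - K p) := by
  induction N with
  | zero =>
    intro p l t hl _ ht0 ht1
    have h1 : K p ≤ K (p + t * l) := hK (by nlinarith)
    have h2 : K (p + t * l) ≤ K (p + l) := hK (by nlinarith)
    rw [abs_le]
    constructor <;> simp only [pow_zero] <;> nlinarith
  | succ N ih =>
    intro p l t hl hld ht0 ht1
    obtain ⟨hA, hB⟩ := h (p + l / 2) (l / 2) (by linarith) (by linarith)
    have e1 : p + l / 2 + l / 2 = p + l := by ring
    have e2 : p + l / 2 - l / 2 = p := by ring
    rw [e1, e2] at hA hB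
    have m1 : K p ≤ K (p + l / 2) := hK (by linarith)
    have m2 : K (p + l / 2) ≤ K (p + l) := hK (by linarith)
    have hθ : (0 : ℝ) < (2 / 3) ^ N := by positivity
    have ps : ((2 : ℝ) / 3) ^ (N + 1) = (2 / 3) ^ N * (2 / 3) := pow_succ _ _
    set θ : ℝ := (2 / 3) ^ N
    rw [ps]
    set A := K (p + l / 2) - K p with hAdef
    set B := K (p + l) - K (p + l / 2) with hBdef
    have hA0 : 0 ≤ A := by linarith
    have hB0 : 0 ≤ B := by linarith
    have hAB : K (p + l) - K p = A + B := by rw [hAdef, hBdef]; ring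
    rw [hAB]
    have hA3 : A ≤ 2 / 3 * (A + B) := by nlinarith
    have hB3 : B ≤ 2 / 3 * (A + B) := by nlinarith
    have hd : |A - B| ≤ e * (A + B) := by
      rw [abs_le]; constructor <;> nlinarith
    have hd0 : 0 ≤ e * (A + B) := by positivity
    rcases le_total t (1 / 2) with ht | ht
    · have := ih p (l / 2) (2 * t) (by linarith) (by linarith) (by linarith) (by linarith)
      have e3 : p + 2 * t * (l / 2) = p + t * l := by ring
      rw [e3, ← hAdef] at this
      have hk : (3 * e + θ) * A ≤ (3 * e + θ) * (2 / 3 * (A + B)) := by gcongr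
      have hs : |t * (A - B)| ≤ 1 * (e * (A + B)) := by
        rw [abs_mul, abs_of_nonneg ht0]; gcongr
      have : K (p + t * l) - (K p + t * (A + B)) =
        (K (p + t * l) - (K p + 2 * t * A)) + t * (A - B) := by ring
      rw [this]
      refine (abs_add_le _ _).trans ?_
      linarith
    · have := ih (p + l / 2) (l / 2) (2 * t - 1) (by linarith) (by linarith) (by linarith)
        (by linarith)
      have e3 : p + l / 2 + (2 * t - 1) * (l / 2) = p + t * l := by ring
      rw [e3, e1, ← hBdef] at this
      have hk : (3 * e + θ) * B ≤ (3 * e + θ) * (2 / 3 * (A + B)) := by gcongr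
      have hs : |(1 - t) * (A - B)| ≤ 1 * (e * (A + B)) := by
        rw [abs_mul, abs_of_nonneg (by linarith)]; gcongr; linarith
      have : K (p + t * l) - (K p + t * (A + B)) =
        (K (p + t * l) - (K (p + l / 2) + (2 * t - 1) * B)) + (1 - t) * (A - B) := by
          rw [hAdef]; ring
      rw [this]
      refine (abs_add_le _ _).trans ?_
      linarith

/-- A monotone function which is almost symmetric at small scales is almost affine there. -/
theorem QuasisymmetricBelow.abs_sub_affine_le {K : ℝ → ℝ} (hK : Monotone K) {e d : ℝ}
    (he0 : 0 ≤ e) (he : e ≤ 1) (h : QuasisymmetricBelow d (1 + e) K) {p l t : ℝ} (hl : 0 < l)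
    (hld : l < d) (ht0 : 0 ≤ t) (ht1 : t ≤ 1) :
    |K (p + t * l) - (K p + t * (K (p + l) - K p))| ≤ 3 * e * (K (p + l) - K p) := by
  have hlim : Filter.Tendsto (fun N : ℕ => (3 * e + (2 / 3 : ℝ) ^ N) * (K (p + l) - K p))
      Filter.atTop (𝓝 ((3 * e + 0) * (K (p + l) - K p))) :=
    ((tendsto_pow_atTop_nhds_zero_of_lt_one (by norm_num) (by norm_num)).const_add _).mul_const _
  rw [add_zero] at hlim
  exact ge_of_tendsto' hlim fun N => h.abs_sub_affine_le_aux hK he0 he N p l t hl hld ht0 ht1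

/-- Each halving keeps at most the share M/(1 + M) of the increment, because the left half is at
most M times the right half. -/
theorem Quasisymmetric.sub_le_pow {M : ℝ} (hM : 0 < M) {K : ℝ → ℝ} (hqs : Quasisymmetric M K)
    {D u : ℝ} (hu : 0 < u) (hD : ∀ x, K (x + u) - K x ≤ D) (j : ℕ) (x : ℝ) :
    K (x + u / 2 ^ j) - K x ≤ D * (M / (1 + M)) ^ j := by
  induction j generalizing x with
  | zero => simpa using hD x
  | succ j ih =>
    have hpos : 0 < u / 2 ^ (j + 1) := by positivity
    have h1 := (hqs (x + u / 2 ^ (j + 1)) _ hpos).2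
    have h2 := ih x
    have e1 : x + u / 2 ^ (j + 1) + u / 2 ^ (j + 1) = x + u / 2 ^ j := by
      rw [pow_succ]; field_simp; ring
    rw [e1, add_sub_cancel_right] at h1
    rw [pow_succ (M / (1 + M)), ← mul_assoc, mul_div_assoc', le_div_iff₀ (by linarith)]
    nlinarith

/-- A flat interval forces the adjacent interval of the same length to be flat; repeating this to
the right covers a unit interval, on which the increment is 1. -/
theorem Quasisymmetric.strictMono {M : ℝ} {G : ℝ → ℝ} (hG : Monotone G)
    (hqs : Quasisymmetric M G) (h1 : ∀ x, G (x + 1) = G x + 1) : StrictMono G := by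
  refine hG.strictMono_of_injective ?_
  have key : ∀ x y : ℝ, 0 < y → G (x + y) ≠ G x := by
    intro x y hy heq
    have hall : ∀ n : ℕ, G (x + n * y) = G x ∧ G (x + (n + 1) * y) = G x := by
      intro n
      induction n with
      | zero => simpa using heq
      | succ n ih =>
        refine ⟨by push_cast; exact ih.2, ?_⟩
        have h := (hqs (x + (n + 1) * y) y hy).1
        have e1 : x + (n + 1) * y - y = x + n * y := by ring
        rw [e1, ih.1, ih.2] at h
        have h2 : G x ≤ G (x + (n + 1) * y + y) := by rw [← ih.2]; exact hG (by linarith)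
        push_cast
        have e2 : x + (n + 1 + 1) * y = x + (n + 1) * y + y := by ring
        rw [e2]
        linarith
    obtain ⟨n, hn⟩ := exists_nat_ge (1 / y)
    have h2 : G (x + 1) ≤ G (x + n * y) := hG (by
      rw [div_le_iff₀ hy] at hn; linarith)
    rw [(hall n).1, h1] at h2
    linarith
  intro a b hab
  rcases lt_trichotomy a b with h | h | h
  · exact absurd (by rw [add_sub_cancel]; exact hab.symm) (key a (b - a) (by linarith))
  · exact h
  · exact absurd (by rw [add_sub_cancel]; exact hab) (key b (a - b) (by linarith))

/-! ### The semiconjugacy of the multiplication by `m` to a lift -/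

theorem IsLift.symm_add_mul {m : ℕ} {f : Circle → Circle} {F : ℝ ≃ₜ ℝ} (hF : IsLift m f F)
    (x : ℝ) : F.symm (x + m) = F.symm x + 1 := by
  rw [Homeomorph.symm_apply_eq, hF.map_add_one, Homeomorph.apply_symm_apply]

theorem IsLift.symm_add_nat_mul {m : ℕ} {f : Circle → Circle} {F : ℝ ≃ₜ ℝ} (hF : IsLift m f F)
    (k : ℕ) (x : ℝ) : F.symm (x + k * m) = F.symm x + k := by
  induction k with
  | zero => simp
  | succ k ih =>
    have : x + ((k + 1 : ℕ) : ℝ) * m = x + k * m + m := by push_cast; ring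
    rw [this, hF.symm_add_mul, ih]; push_cast; ring

theorem IsLift.iterate_symm_add_pow {m : ℕ} {f : Circle → Circle} {F : ℝ ≃ₜ ℝ} (hF : IsLift m f F)
    (n : ℕ) : ∀ x : ℝ, (F.symm^[n]) (x + m ^ n) = (F.symm^[n]) x + 1 := by
  induction n with
  | zero => simp
  | succ n ih =>
    intro x
    have := hF.symm_add_nat_mul (m ^ n) x
    rw [Function.iterate_succ_apply, Function.iterate_succ_apply, pow_succ, ← ih]
    push_cast at this
    rw [this]

theorem IsLift.strictMono_iterate_symm {m : ℕ} {f : Circle → Circle} {F : ℝ ≃ₜ ℝ}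
    (hF : IsLift m f F) (n : ℕ) : StrictMono (F.symm^[n]) := by
  refine StrictMono.iterate ?_ n
  intro a b hab
  by_contra! hc
  have := hF.strictMono.monotone hc
  simp at this
  linarith

theorem rho_bounds_iff {K : ℝ → ℝ} (hK : StrictMono K) {x y c : ℝ} (hy : 0 < y) (hc : 0 < c) :
    (1 / c ≤ rho K x y ∧ rho K x y ≤ c) ↔
      K (x + y) - K x ≤ c * (K x - K (x - y)) ∧ K x - K (x - y) ≤ c * (K (x + y) - K x) := by
  have h : 0 < K x - K (x - y) := sub_pos.2 (hK (by linarith))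
  rw [rho, div_le_iff₀ h, div_le_div_iff₀ hc h, and_comm, one_mul, mul_comm c (K (x + y) - K x)]

/-- F⁻ⁿ has increment 1 over length mⁿ ≥ 2ⁿ, so n halvings bound its unit increments by θⁿ with θ =
M/(1 + M) < 1. As u ↦ F⁻¹(m u) - u is periodic, hence bounded, the maps F⁻ⁿ(mⁿ x) form a uniformly
geometric Cauchy sequence. Quasisymmetry passes to the limit and makes it strictly increasing. -/
theorem IsLift.exists_semiconj {m : ℕ} (hm : 2 ≤ m) {f : Circle → Circle} {F : ℝ ≃ₜ ℝ}
    (hF : IsLift m f F) {M : ℝ} (hM : 1 ≤ M)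
    (hqs : ∀ n : ℕ, 1 ≤ n → Quasisymmetric M (F.symm^[n])) :
    ∃ G : ℝ → ℝ, Continuous G ∧ StrictMono G ∧ (∀ x, G (x + 1) = G x + 1) ∧
      (∀ x, G (m * x) = F (G x)) ∧ Quasisymmetric M G := by
  have hm0 : (0 : ℝ) < m := by positivity
  have hmono := fun n => (hF.strictMono_iterate_symm n).monotone
  set θ : ℝ := M / (1 + M) with hθdef
  have hθ0 : 0 ≤ θ := by positivity
  have hθ1 : θ < 1 := by rw [hθdef, div_lt_one (by linarith)]; linarith
  -- unit steps are contracted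
  have hstep : ∀ n : ℕ, ∀ x, (F.symm^[n]) (x + 1) - (F.symm^[n]) x ≤ θ ^ n := by
    intro n x
    rcases Nat.eq_zero_or_pos n with rfl | hn
    · simp
    have h1 := (hqs n hn).sub_le_pow (by linarith) (D := 1) (u := (m : ℝ) ^ n) (by positivity)
      (fun x => by rw [hF.iterate_symm_add_pow]; linarith) n x
    have h2 : (F.symm^[n]) (x + 1) ≤ (F.symm^[n]) (x + (m : ℝ) ^ n / 2 ^ n) := hmono n (by
      have : (1 : ℝ) ≤ (m : ℝ) ^ n / 2 ^ n := by
        rw [le_div_iff₀ (by positivity), one_mul]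
        gcongr; exact_mod_cast hm
      linarith)
    rw [one_mul] at h1
    linarith
  have hsteps : ∀ n N : ℕ, ∀ x, (F.symm^[n]) (x + N) - (F.symm^[n]) x ≤ N * θ ^ n := by
    intro n N x
    induction N with
    | zero => simp
    | succ N ih =>
      have := hstep n (x + N)
      push_cast
      rw [← add_assoc]
      linarith
  have hcontr : ∀ n N : ℕ, ∀ a b : ℝ, |a - b| ≤ N →
      |(F.symm^[n]) a - (F.symm^[n]) b| ≤ N * θ ^ n := by
    intro n N a b hab
    rw [abs_le] at hab ⊢
    have h1 := hmono n (show a ≤ b + N by linarith)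
    have h2 := hmono n (show b ≤ a + N by linarith)
    have := hsteps n N a
    have := hsteps n N b
    constructor <;> linarith
  -- the displacement is bounded
  obtain ⟨N, hN⟩ : ∃ N : ℕ, ∀ u : ℝ, |F.symm (m * u) - u| ≤ N := by
    obtain ⟨C, hC⟩ := (isCompact_Icc (a := (0 : ℝ)) (b := 1)).exists_bound_of_continuousOn
      (f := fun u : ℝ => F.symm (m * u) - u) (by fun_prop)
    obtain ⟨N, hN⟩ := exists_nat_ge C
    refine ⟨N, fun u => ?_⟩
    have hper : Function.Periodic (fun u : ℝ => F.symm (m * u) - u) 1 := by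
      intro u
      simp only
      rw [mul_add, mul_one, hF.symm_add_mul]; ring
    obtain ⟨v, hv, hv2⟩ := hper.exists_mem_Ico₀ one_pos u
    rw [hv2]
    exact (hC v ⟨hv.1, hv.2.le⟩).trans hN
  set g : ℕ → ℝ → ℝ := fun n x => (F.symm^[n]) ((m : ℝ) ^ n * x) with hg
  have hdist : ∀ x n, dist (g n x) (g (n + 1) x) ≤ N * θ ^ n := by
    intro x n
    rw [Real.dist_eq, hg]
    simp only [Function.iterate_succ_apply]
    apply hcontr
    rw [abs_sub_comm, pow_succ, mul_comm ((m : ℝ) ^ n) m, mul_assoc]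
    exact hN _
  have hlim : ∀ x, ∃ y, Filter.Tendsto (fun n => g n x) Filter.atTop (𝓝 y) := fun x =>
    cauchySeq_tendsto_of_complete (cauchySeq_of_le_geometric θ N hθ1 (hdist x))
  choose G hG using hlim
  have hgc : ∀ n, Continuous (g n) := fun n =>
    (F.symm.continuous.iterate n).comp (continuous_const.mul continuous_id)
  have hunif : TendstoUniformly g G Filter.atTop := by
    rw [Metric.tendstoUniformly_iff]
    intro ε hε
    have h0 : Filter.Tendsto (fun n : ℕ => N * θ ^ n / (1 - θ)) Filter.atTop (𝓝 0) := by
      simpa using ((tendsto_pow_atTop_nhds_zero_of_lt_one hθ0 hθ1).const_mul (N : ℝ)).div_const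
        (1 - θ)
    filter_upwards [h0.eventually_lt_const hε] with n hn x
    rw [dist_comm]
    exact (dist_le_of_le_geometric_of_tendsto θ N hθ1 (hdist x) (hG x) n).trans_lt hn
  have hGmono : Monotone G := fun a b hab =>
    le_of_tendsto_of_tendsto' (hG a) (hG b) fun n => hmono n (by gcongr)
  have hG1 : ∀ x, G (x + 1) = G x + 1 := by
    intro x
    refine tendsto_nhds_unique (hG (x + 1)) (((hG x).add_const 1).congr fun n => ?_)
    change (F.symm^[n]) ((m : ℝ) ^ n * x) + 1 = (F.symm^[n]) ((m : ℝ) ^ n * (x + 1))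
    rw [mul_add, mul_one, hF.iterate_symm_add_pow]
  have hGqs : Quasisymmetric M G := by
    intro x y hy
    have e1 : ∀ n : ℕ, (m : ℝ) ^ n * (x + y) = (m : ℝ) ^ n * x + (m : ℝ) ^ n * y :=
      fun n => by ring
    have e2 : ∀ n : ℕ, (m : ℝ) ^ n * (x - y) = (m : ℝ) ^ n * x - (m : ℝ) ^ n * y :=
      fun n => by ring
    constructor
    · refine le_of_tendsto_of_tendsto ((hG (x + y)).sub (hG x))
        (((hG x).sub (hG (x - y))).const_mul M) ?_
      filter_upwards [Filter.eventually_ge_atTop 1] with n hn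
      simp only [hg, e1, e2]
      exact (hqs n hn _ _ (by positivity)).1
    · refine le_of_tendsto_of_tendsto ((hG x).sub (hG (x - y)))
        (((hG (x + y)).sub (hG x)).const_mul M) ?_
      filter_upwards [Filter.eventually_ge_atTop 1] with n hn
      simp only [hg, e1, e2]
      exact (hqs n hn _ _ (by positivity)).2
  refine ⟨G, hunif.continuous (Filter.Frequently.of_forall hgc), hGqs.strictMono hGmono hG1, hG1,
    fun x => ?_, hGqs⟩
  -- Applying F to the (n + 1)-st approximation at x gives the n-th approximation at m x; the
  -- equation follows in the limit.
  have h1 := (F.continuous.tendsto _).comp ((hG x).comp (Filter.tendsto_add_atTop_nat 1))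
  refine tendsto_nhds_unique (hG (m * x)) (h1.congr fun n => ?_)
  simp only [Function.comp, hg]
  rw [Function.iterate_succ_apply', Homeomorph.apply_symm_apply, pow_succ, mul_assoc]

/-! ### The Beurling–Ahlfors extension -/

/-- The mean of `G` over the interval with end points `x` and `x + y`, where `z = x + i y`. -/
def mean (G : ℝ → ℝ) (z : ℂ) : ℝ := ∫ t in (0 : ℝ)..1, G (z.re + z.im * t)

/-- The Beurling–Ahlfors extension of `G`, symmetric with respect to the real line. -/
def beurlingAhlfors (G : ℝ → ℝ) (z : ℂ) : ℂ :=
  (((mean G z + mean G ((starRingEnd ℂ) z)) / 2 : ℝ) : ℂ) +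
    (((mean G z - mean G ((starRingEnd ℂ) z)) / 2 : ℝ) : ℂ) * Complex.I

/-- The derivative of `mean G`. -/
def meanDeriv (G : ℝ → ℝ) (z : ℂ) : ℂ →L[ℝ] ℝ :=
  ((G (z.re + z.im) - G z.re) / z.im) • Complex.reCLM +
    ((G (z.re + z.im) - mean G z) / z.im) • Complex.imCLM

/-- The derivative of `beurlingAhlfors G`. -/
def beurlingAhlforsDeriv (G : ℝ → ℝ) (z : ℂ) : ℂ →L[ℝ] ℂ :=
  Complex.ofRealCLM.comp ((1 / 2 : ℝ) • (meanDeriv G z +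
    (meanDeriv G ((starRingEnd ℂ) z)).comp (Complex.conjCLE : ℂ →L[ℝ] ℂ))) +
  Complex.I • Complex.ofRealCLM.comp ((1 / 2 : ℝ) • (meanDeriv G z -
    (meanDeriv G ((starRingEnd ℂ) z)).comp (Complex.conjCLE : ℂ →L[ℝ] ℂ)))

section basic

variable {G : ℝ → ℝ}

@[simp] theorem beurlingAhlfors_re (z : ℂ) :
    (beurlingAhlfors G z).re = (mean G z + mean G ((starRingEnd ℂ) z)) / 2 := by
  simp [beurlingAhlfors, -Complex.ofReal_add, -Complex.ofReal_sub, -Complex.ofReal_div]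

@[simp] theorem beurlingAhlfors_im (z : ℂ) :
    (beurlingAhlfors G z).im = (mean G z - mean G ((starRingEnd ℂ) z)) / 2 := by
  simp [beurlingAhlfors, -Complex.ofReal_add, -Complex.ofReal_sub, -Complex.ofReal_div]

theorem meanDeriv_apply (z v : ℂ) : meanDeriv G z v =
    (G (z.re + z.im) - G z.re) / z.im * v.re + (G (z.re + z.im) - mean G z) / z.im * v.im := by
  simp [meanDeriv]

theorem beurlingAhlforsDeriv_re (z v : ℂ) : (beurlingAhlforsDeriv G z v).re =
    (meanDeriv G z v + meanDeriv G ((starRingEnd ℂ) z) ((starRingEnd ℂ) v)) / 2 := by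
  simp [beurlingAhlforsDeriv]; ring

theorem beurlingAhlforsDeriv_im (z v : ℂ) : (beurlingAhlforsDeriv G z v).im =
    (meanDeriv G z v - meanDeriv G ((starRingEnd ℂ) z) ((starRingEnd ℂ) v)) / 2 := by
  simp [beurlingAhlforsDeriv]; ring

theorem beurlingAhlfors_conj (z : ℂ) :
    beurlingAhlfors G ((starRingEnd ℂ) z) = (starRingEnd ℂ) (beurlingAhlfors G z) := by
  apply Complex.ext
  · simp [add_comm]
  · simp; ring

theorem beurlingAhlfors_ofReal (x : ℝ) : beurlingAhlfors G x = G x := by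
  apply Complex.ext <;> simp [mean]

theorem continuous_mean (hG : Continuous G) : Continuous (mean G) := by
  refine intervalIntegral.continuous_parametric_intervalIntegral_of_continuous' ?_ 0 1
  simp only [Function.uncurry_def]
  fun_prop

theorem continuous_beurlingAhlfors (hG : Continuous G) : Continuous (beurlingAhlfors G) := by
  have := continuous_mean hG
  unfold beurlingAhlfors
  fun_prop

theorem mean_add_one (hG : Continuous G) (h1 : ∀ x, G (x + 1) = G x + 1) (z : ℂ) :
    mean G (z + 1) = mean G z + 1 := by
  have : ∀ t : ℝ, G ((z + 1).re + (z + 1).im * t) = G (z.re + z.im * t) + 1 := by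
    intro t
    rw [← h1]; congr 1; simp; ring
  simp only [mean, this]
  rw [intervalIntegral.integral_add (by apply Continuous.intervalIntegrable; fun_prop) (by simp)]
  simp

theorem beurlingAhlfors_add_one (hG : Continuous G) (h1 : ∀ x, G (x + 1) = G x + 1) (z : ℂ) :
    beurlingAhlfors G (z + 1) = beurlingAhlfors G z + 1 := by
  apply Complex.ext
  · simp [mean_add_one hG h1]; ring
  · simp [mean_add_one hG h1]

theorem mean_comp_mul (c : ℝ) (z : ℂ) :
    mean (fun x => G (c * x)) z = mean G (c * z) := by
  simp [mean, mul_add, mul_assoc]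

theorem beurlingAhlfors_comp_mul (c : ℝ) (z : ℂ) :
    beurlingAhlfors (fun x => G (c * x)) z = beurlingAhlfors G (c * z) := by
  simp [beurlingAhlfors, mean_comp_mul]

/-- With P a primitive of G, y times the mean equals P(x + y) - P(x), so continuity of G suffices.
Strict differentiability is what the inverse function theorem needs later. -/
theorem hasStrictFDerivAt_mean (hG : Continuous G) {z : ℂ} (hz : z.im ≠ 0) :
    HasStrictFDerivAt (mean G) (meanDeriv G z) z := by
  have hP := hG.integral_hasStrictDerivAt 0
  set P : ℝ → ℝ := fun u => ∫ x in (0 : ℝ)..u, G x with hPdef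
  have hform : ∀ w : ℂ, w.im * mean G w = P (w.re + w.im) - P w.re := by
    intro w
    rw [mean, intervalIntegral.mul_integral_comp_add_mul, hPdef]
    simp only [mul_zero, add_zero, mul_one]
    rw [intervalIntegral.integral_interval_sub_left] <;> exact hG.intervalIntegrable _ _
  have hre : HasStrictFDerivAt (fun w : ℂ => w.re) Complex.reCLM z :=
    Complex.reCLM.hasStrictFDerivAt
  have him : HasStrictFDerivAt (fun w : ℂ => w.im) Complex.imCLM z :=
    Complex.imCLM.hasStrictFDerivAt
  have h1 := ((hP (z.re + z.im)).comp_hasStrictFDerivAt z (hre.add him)).sub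
    ((hP z.re).comp_hasStrictFDerivAt z hre)
  have h2 := h1.mul ((hasStrictDerivAt_inv hz).comp_hasStrictFDerivAt z him)
  have h3 := h2.congr_of_eventuallyEq (f₁ := mean G) (by
    filter_upwards [Complex.continuous_im.continuousAt.eventually_ne hz] with w hw
    have := hform w
    simp only [Pi.mul_apply, Pi.sub_apply, Function.comp_apply, Pi.add_apply]
    rw [← this]; field_simp)
  refine h3.congr_fderiv (ContinuousLinearMap.ext fun v => ?_)
  rw [meanDeriv_apply]
  simp
  rw [← hform z]
  field_simp
  ring

theorem hasStrictFDerivAt_beurlingAhlfors (hG : Continuous G) {z : ℂ} (hz : z.im ≠ 0) :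
    HasStrictFDerivAt (beurlingAhlfors G) (beurlingAhlforsDeriv G z) z := by
  have h1 := hasStrictFDerivAt_mean hG hz
  have h2 : HasStrictFDerivAt (fun w => mean G ((starRingEnd ℂ) w)) _ z :=
    (hasStrictFDerivAt_mean hG (z := (starRingEnd ℂ) z) (by simpa using hz)).comp z
      (Complex.conjCLE : ℂ →L[ℝ] ℂ).hasStrictFDerivAt
  have h3 := Complex.ofRealCLM.hasStrictFDerivAt.comp z ((h1.add h2).const_smul (1 / 2 : ℝ))
  have h4 := (Complex.ofRealCLM.hasStrictFDerivAt.comp z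
    ((h1.sub h2).const_smul (1 / 2 : ℝ))).const_smul Complex.I
  refine (h3.add h4).congr_of_eventuallyEq (Filter.Eventually.of_forall fun w => ?_)
  simp [beurlingAhlfors]
  ring

end basic

/-! ### The extension is a homeomorphism -/

section homeo

variable {G : ℝ → ℝ}

theorem mean_lt_mean (hG : Continuous G) (hm : StrictMono G) {z w : ℂ} (hre : z.re ≤ w.re)
    (him : z.im ≤ w.im) (hne : z ≠ w) : mean G z < mean G w := by
  refine intervalIntegral.integral_lt_integral_of_continuousOn_of_le_of_exists_lt one_pos
    (by fun_prop) (by fun_prop) (fun t ht => hm.monotone ?_) ⟨1, by simp, hm ?_⟩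
  · have := mul_le_mul_of_nonneg_right him ht.1.le
    linarith
  · rcases hre.lt_or_eq with h | h
    · linarith
    · rcases him.lt_or_eq with h' | h'
      · linarith
      · exact absurd (Complex.ext h h') hne

/-- The image determines the means at z and at its conjugate. If the real and imaginary parts of two
points are ordered the same way, the first mean separates them; if oppositely, the second does. -/
theorem beurlingAhlfors_injective (hG : Continuous G) (hm : StrictMono G) :
    Function.Injective (beurlingAhlfors G) := by
  intro z w hzw
  have h1 := congrArg Complex.re hzw
  have h2 := congrArg Complex.im hzw
  simp only [beurlingAhlfors_re, beurlingAhlfors_im] at h1 h2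
  by_contra hne
  have hne' : (starRingEnd ℂ) z ≠ (starRingEnd ℂ) w := fun h =>
    hne (star_injective h)
  rcases le_total z.re w.re with hr | hr <;> rcases le_total z.im w.im with hi | hi
  · have := mean_lt_mean hG hm hr hi hne
    linarith
  · have := mean_lt_mean hG hm (z := (starRingEnd ℂ) z) (w := (starRingEnd ℂ) w) (by simpa)
      (by simpa) hne'
    linarith
  · have := mean_lt_mean hG hm (z := (starRingEnd ℂ) w) (w := (starRingEnd ℂ) z) (by simpa)
      (by simpa) hne'.symm
    linarith
  · have := mean_lt_mean hG hm hr hi (Ne.symm hne)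
    linarith

theorem beurlingAhlfors_im_pos (hG : Continuous G) (hm : StrictMono G) {z : ℂ} (hz : 0 < z.im) :
    0 < (beurlingAhlfors G z).im := by
  have := mean_lt_mean hG hm (z := (starRingEnd ℂ) z) (w := z) (by simp) (by simp; linarith)
    (fun h => by have := congrArg Complex.im h; simp at this; linarith)
  rw [beurlingAhlfors_im]; linarith

theorem beurlingAhlfors_im_pos_iff (hG : Continuous G) (hm : StrictMono G) {z : ℂ} :
    0 < (beurlingAhlfors G z).im ↔ 0 < z.im := by
  refine ⟨fun h => ?_, beurlingAhlfors_im_pos hG hm⟩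
  by_contra! hz
  rcases hz.lt_or_eq with hz | hz
  · have := beurlingAhlfors_im_pos hG hm (z := (starRingEnd ℂ) z) (by simpa using hz)
    rw [beurlingAhlfors_conj, Complex.conj_im] at this
    linarith
  · rw [← Complex.conj_eq_iff_im] at hz
    rw [beurlingAhlfors_im, hz] at h
    simp at h

theorem beurlingAhlfors_im_eq_zero_iff (hG : Continuous G) (hm : StrictMono G) {z : ℂ} :
    (beurlingAhlfors G z).im = 0 ↔ z.im = 0 := by
  have h1 := beurlingAhlfors_im_pos_iff hG hm (z := z)
  have h2 := beurlingAhlfors_im_pos_iff hG hm (z := (starRingEnd ℂ) z)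
  rw [beurlingAhlfors_conj, Complex.conj_im, Complex.conj_im] at h2
  constructor <;> intro h <;> apply le_antisymm <;> by_contra! hc
  · rw [← h1] at hc; linarith
  · have := h2.2 (by linarith); linarith
  · rw [h1] at hc; linarith
  · have := h2.1 (by linarith); linarith

theorem exists_abs_sub_id_le (hG : Continuous G) (h1 : ∀ x, G (x + 1) = G x + 1) :
    ∃ C : ℝ, ∀ x, |G x - x| ≤ C := by
  obtain ⟨C, hC⟩ := (isCompact_Icc (a := (0 : ℝ)) (b := 1)).exists_bound_of_continuousOn
    (f := fun u : ℝ => G u - u) (by fun_prop)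
  refine ⟨C, fun u => ?_⟩
  have hper : Function.Periodic (fun u : ℝ => G u - u) 1 := by
    intro u
    simp only [h1]; ring
  obtain ⟨v, hv, hv2⟩ := hper.exists_mem_Ico₀ one_pos u
  rw [hv2]
  exact hC v ⟨hv.1, hv.2.le⟩

theorem abs_mean_sub_le (hG : Continuous G) {C : ℝ} (hC : ∀ x, |G x - x| ≤ C) (z : ℂ) :
    |mean G z - (z.re + z.im / 2)| ≤ C := by
  have h : mean G z - (z.re + z.im / 2) =
      ∫ t in (0 : ℝ)..1, (G (z.re + z.im * t) - (z.re + z.im * t)) := by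
    rw [intervalIntegral.integral_sub (by apply Continuous.intervalIntegrable; fun_prop)
      (by apply Continuous.intervalIntegrable; fun_prop)]
    rw [intervalIntegral.integral_add (by simp)
      (by apply Continuous.intervalIntegrable; fun_prop)]
    rw [intervalIntegral.integral_const_mul, integral_id]
    simp [mean]
    ring
  rw [h, ← Real.norm_eq_abs]
  have := intervalIntegral.norm_integral_le_of_norm_le_const (a := (0 : ℝ)) (b := 1) (C := C)
    (f := fun t => G (z.re + z.im * t) - (z.re + z.im * t)) (fun t _ => hC _)
  simpa using this

/-- G stays at bounded distance from the identity, so the extension stays at bounded distance from x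
+ iy ↦ x + iy/2. -/
theorem tendsto_beurlingAhlfors_cocompact (hG : Continuous G) (h1 : ∀ x, G (x + 1) = G x + 1) :
    Filter.Tendsto (beurlingAhlfors G) (Filter.cocompact ℂ) (Filter.cocompact ℂ) := by
  obtain ⟨C, hC⟩ := exists_abs_sub_id_le hG h1
  have hb : ∀ z : ℂ, 1 / 4 * ‖z‖ - 2 * C ≤ ‖beurlingAhlfors G z‖ := by
    intro z
    have h2 := abs_le.1 (abs_mean_sub_le hG hC z)
    have h3 := abs_le.1 (abs_mean_sub_le hG hC ((starRingEnd ℂ) z))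
    simp only [Complex.conj_re, Complex.conj_im] at h3
    have h4 := Complex.abs_re_le_norm (beurlingAhlfors G z)
    have h5 := Complex.abs_im_le_norm (beurlingAhlfors G z)
    have h6 := Complex.norm_le_abs_re_add_abs_im z
    rw [beurlingAhlfors_re] at h4
    rw [beurlingAhlfors_im] at h5
    have h7 : |z.re| ≤ |(mean G z + mean G ((starRingEnd ℂ) z)) / 2| + C := by
      refine abs_le.2 ⟨?_, ?_⟩
      · have := neg_abs_le ((mean G z + mean G ((starRingEnd ℂ) z)) / 2); linarith
      · have := le_abs_self ((mean G z + mean G ((starRingEnd ℂ) z)) / 2); linarith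
    have h8 : |z.im / 2| ≤ |(mean G z - mean G ((starRingEnd ℂ) z)) / 2| + C := by
      refine abs_le.2 ⟨?_, ?_⟩
      · have := neg_abs_le ((mean G z - mean G ((starRingEnd ℂ) z)) / 2); linarith
      · have := le_abs_self ((mean G z - mean G ((starRingEnd ℂ) z)) / 2); linarith
    rw [abs_div, abs_two] at h8
    have := norm_nonneg (beurlingAhlfors G z)
    have : 0 ≤ C := (abs_nonneg _).trans (hC 0)
    linarith
  rw [← Metric.cobounded_eq_cocompact, ← tendsto_norm_atTop_iff_cobounded]
  refine Filter.tendsto_atTop_mono hb (Filter.tendsto_atTop_add_const_right _ _ ?_)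
  exact tendsto_norm_cobounded_atTop.const_mul_atTop (by norm_num)

theorem surjective_of_add_one (hG : Continuous G) (h1 : ∀ x, G (x + 1) = G x + 1) :
    Function.Surjective G := by
  obtain ⟨C, hC⟩ := exists_abs_sub_id_le hG h1
  refine hG.surjective ?_ ?_
  · refine Filter.tendsto_atTop_mono (f := fun x => x - C) (fun x => ?_)
      (Filter.tendsto_atTop_add_const_right _ _ Filter.tendsto_id)
    have := (abs_le.1 (hC x)).1
    linarith
  · refine Filter.tendsto_atBot_mono (f := fun x => x + C) (fun x => ?_)
      (Filter.tendsto_atBot_add_const_right _ _ Filter.tendsto_id)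
    have := (abs_le.1 (hC x)).2
    linarith

end homeo

/-! ### Estimates for the derivative -/

section estimates

variable {G : ℝ → ℝ}

theorem integral_le_of_monotone {f : ℝ → ℝ} (hf : Continuous f) (hm : MonotoneOn f (Set.Icc 0 1)) :
    ∫ t in (0 : ℝ)..1, f t ≤ (f (1 / 2) + f 1) / 2 := by
  rw [← intervalIntegral.integral_add_adjacent_intervals (hf.intervalIntegrable 0 (1 / 2))
    (hf.intervalIntegrable (1 / 2) 1)]
  have h1 : ∫ t in (0 : ℝ)..(1 / 2), f t ≤ ∫ t in (0 : ℝ)..(1 / 2), f (1 / 2) := by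
    refine intervalIntegral.integral_mono_on (by norm_num) (hf.intervalIntegrable _ _) (by simp) ?_
    intro t ht
    exact hm ⟨ht.1, ht.2.trans (by norm_num)⟩ (by norm_num) ht.2
  have h2 : ∫ t in (1 / 2 : ℝ)..1, f t ≤ ∫ t in (1 / 2 : ℝ)..1, f 1 := by
    refine intervalIntegral.integral_mono_on (by norm_num) (hf.intervalIntegrable _ _) (by simp) ?_
    intro t ht
    exact hm ⟨(by norm_num : (0 : ℝ) ≤ 1 / 2).trans ht.1, ht.2⟩ (by norm_num) ht.2
  simp only [intervalIntegral.integral_const, smul_eq_mul] at h1 h2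
  linarith

/-- For y > 0 the mean is at most the average of G(x + y/2) and G(x + y), so G(x + y) minus the mean
is at least half the increment over [x + y/2, x + y]. Two uses of quasisymmetry, each costing 1 + M,
compare this with the increment over [x - y, x + y]. The case y < 0 is the mirror image. -/
theorem le_coeff_meanDeriv (hG : Continuous G) (hm : StrictMono G) {M : ℝ} (hM : 0 < M)
    (hqs : Quasisymmetric M G) {z : ℂ} (hz : z.im ≠ 0) :
    (1 / (2 * (1 + M) ^ 2)) * ((G (z.re + |z.im|) - G (z.re - |z.im|)) / |z.im|) ≤
        (G (z.re + z.im) - G z.re) / z.im ∧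
      (1 / (2 * (1 + M) ^ 2)) * ((G (z.re + |z.im|) - G (z.re - |z.im|)) / |z.im|) ≤
        (G (z.re + z.im) - mean G z) / z.im := by
  set x := z.re with hx
  set y := |z.im| with hy
  have hy0 : 0 < y := abs_pos.2 hz
  obtain ⟨q1, q2⟩ := hqs x y hy0
  have hp : 0 ≤ G (x + y) - G x := sub_nonneg.2 (hm.monotone (by linarith))
  have hn : 0 ≤ G x - G (x - y) := sub_nonneg.2 (hm.monotone (by linarith))
  set ℓ := G (x + y) - G (x - y) with hℓ
  have hp' : ℓ ≤ (1 + M) * (G (x + y) - G x) := by rw [hℓ]; linarith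
  have hn' : ℓ ≤ (1 + M) * (G x - G (x - y)) := by rw [hℓ]; linarith
  have hM2 : (0 : ℝ) < 2 * (1 + M) ^ 2 := by positivity
  have red : ∀ A : ℝ, ℓ ≤ 2 * (1 + M) ^ 2 * A → 1 / (2 * (1 + M) ^ 2) * (ℓ / y) ≤ A / y := by
    intro A hA
    rw [← mul_div_assoc]
    gcongr
    rw [one_div, inv_mul_le_iff₀ hM2]
    exact hA
  have key : ∀ B D : ℝ, 0 ≤ B → D ≤ (1 + M) * B → D ≤ 2 * (1 + M) ^ 2 * B := by
    intro B D hB h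
    nlinarith [mul_nonneg hB (mul_nonneg hM.le hM.le), mul_nonneg hB hM.le]
  have fin : ∀ B D : ℝ, ℓ ≤ (1 + M) * B → B ≤ (1 + M) * (2 * D) → ℓ ≤ 2 * (1 + M) ^ 2 * D := by
    intro B D h h'
    nlinarith
  rcases lt_or_gt_of_ne hz with hneg | hpos
  · have e : z.im = -y := by rw [hy, abs_of_neg hneg, neg_neg]
    rw [e]
    constructor
    · rw [div_neg, ← neg_div]
      apply red
      refine key _ _ ?_ ?_ <;> rw [← sub_eq_add_neg] <;> linarith
    · rw [div_neg, ← neg_div]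
      apply red
      have h1 := integral_le_of_monotone (f := fun t => -G (x + -y * t)) (by fun_prop)
        (fun s _ t _ hst => neg_le_neg (hm.monotone (by nlinarith)))
      rw [intervalIntegral.integral_neg] at h1
      have h2 : mean G z = ∫ t in (0 : ℝ)..1, G (x + -y * t) := by rw [mean, e]
      rw [← h2] at h1
      obtain ⟨q3, q4⟩ := hqs (x - y / 2) (y / 2) (by linarith)
      have e1 : x - y / 2 + y / 2 = x := by ring
      have e2 : x - y / 2 - y / 2 = x - y := by ring
      have e3 : x + -y * (1 / 2) = x - y / 2 := by ring
      have e4 : x + -y * 1 = x - y := by ring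
      rw [e1, e2] at q3
      rw [e3, e4] at h1
      rw [← sub_eq_add_neg]
      refine fin _ _ hn' ?_
      nlinarith
  · have e : z.im = y := by rw [hy, abs_of_pos hpos]
    rw [e]
    constructor
    · exact red _ (key _ _ hp hp')
    · apply red
      have h1 := integral_le_of_monotone (f := fun t => G (x + y * t)) (by fun_prop)
        (fun s _ t _ hst => hm.monotone (by nlinarith))
      have h2 : mean G z = ∫ t in (0 : ℝ)..1, G (x + y * t) := by rw [mean, e]
      rw [← h2] at h1
      obtain ⟨q3, q4⟩ := hqs (x + y / 2) (y / 2) (by linarith)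
      have e1 : x + y / 2 + y / 2 = x + y := by ring
      have e2 : x + y / 2 - y / 2 = x := by ring
      have e3 : x + y * (1 / 2) = x + y / 2 := by ring
      have e4 : x + y * 1 = x + y := by ring
      rw [e1, e2] at q4
      rw [e3, e4] at h1
      refine fin _ _ hp' ?_
      nlinarith

/-- The derivative of the extension of a quasisymmetric function is bounded from below. -/
theorem le_norm_beurlingAhlforsDeriv (hG : Continuous G) (hm : StrictMono G) {M : ℝ} (hM : 0 < M)
    (hqs : Quasisymmetric M G) {z : ℂ} (hz : z.im ≠ 0) (v : ℂ) :
    (1 / (4 * (1 + M) ^ 2)) * ((G (z.re + |z.im|) - G (z.re - |z.im|)) / |z.im|) * ‖v‖ ≤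
      ‖beurlingAhlforsDeriv G z v‖ := by
  obtain ⟨a1, a2⟩ := le_coeff_meanDeriv hG hm hM hqs hz
  obtain ⟨b1, b2⟩ := le_coeff_meanDeriv hG hm hM hqs (z := (starRingEnd ℂ) z) (by simpa using hz)
  have hA := meanDeriv_apply (G := G) z v
  have hB := meanDeriv_apply (G := G) ((starRingEnd ℂ) z) ((starRingEnd ℂ) v)
  have hre := beurlingAhlforsDeriv_re (G := G) z v
  have him := beurlingAhlforsDeriv_im (G := G) z v
  have hℓ : 0 ≤ (G (z.re + |z.im|) - G (z.re - |z.im|)) / |z.im| :=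
    div_nonneg (sub_nonneg.2 (hm.monotone (by linarith [abs_nonneg z.im]))) (abs_nonneg _)
  have n1 := Complex.abs_re_le_norm (beurlingAhlforsDeriv G z v)
  have n2 := Complex.abs_im_le_norm (beurlingAhlforsDeriv G z v)
  have nv := Complex.norm_le_abs_re_add_abs_im v
  simp only [Complex.conj_re, Complex.conj_im, abs_neg] at b1 b2 hB
  set c := (1 / (2 * (1 + M) ^ 2)) * ((G (z.re + |z.im|) - G (z.re - |z.im|)) / |z.im|) with hc
  have hc0 : 0 ≤ c := by positivity
  have hc2 : (1 / (4 * (1 + M) ^ 2)) * ((G (z.re + |z.im|) - G (z.re - |z.im|)) / |z.im|) =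
      c / 2 := by rw [hc]; field_simp; ring
  rw [hc2]
  set A := meanDeriv G z v
  set B := meanDeriv G ((starRingEnd ℂ) z) ((starRingEnd ℂ) v)
  have two : ∀ p q a b : ℝ, c ≤ p → c ≤ q → 0 ≤ a → 0 ≤ b → c * (a + b) ≤ |p * a + q * b| := by
    intro p q a b hp hq ha hb
    refine le_trans ?_ (le_abs_self _)
    nlinarith
  -- All four coefficients are at least c. If `v.re` and `v.im` have the same sign, the two terms of
  -- A do not cancel; otherwise those of B do not.
  have hmax : c * (|v.re| + |v.im|) ≤ max |A| |B| := by
    rcases le_total 0 v.re with h1 | h1 <;> rcases le_total 0 v.im with h2 | h2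
    · refine le_max_of_le_left ?_
      rw [hA, abs_of_nonneg h1, abs_of_nonneg h2]
      exact two _ _ _ _ a1 a2 h1 h2
    · refine le_max_of_le_right ?_
      rw [hB, abs_of_nonneg h1, abs_of_nonpos h2]
      exact two _ _ _ _ b1 b2 h1 (by linarith)
    · refine le_max_of_le_right ?_
      rw [hB, abs_of_nonpos h1, abs_of_nonneg h2, ← abs_neg (_ + _), neg_add, ← mul_neg, ← mul_neg,
        neg_neg]
      exact two _ _ _ _ b1 b2 (by linarith) h2
    · refine le_max_of_le_left ?_
      rw [hA, abs_of_nonpos h1, abs_of_nonpos h2, ← abs_neg (_ + _), neg_add, ← mul_neg, ← mul_neg]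
      exact two _ _ _ _ a1 a2 (by linarith) (by linarith)
  -- A and B are the sum and the difference of the real and imaginary parts of the derivative.
  have hN : max |A| |B| ≤ 2 * ‖beurlingAhlforsDeriv G z v‖ := by
    rw [hre] at n1
    rw [him] at n2
    refine max_le ?_ ?_
    · have : A = (A + B) / 2 + (A - B) / 2 := by ring
      rw [this]
      refine (abs_add_le _ _).trans ?_
      linarith
    · have : B = (A + B) / 2 - (A - B) / 2 := by ring
      rw [this]
      refine (abs_sub _ _).trans ?_
      linarith
  nlinarith [mul_le_mul_of_nonneg_left nv hc0]

theorem abs_meanDeriv_le {E : ℝ → ℝ} {z : ℂ} (hz : z.im ≠ 0) {δ : ℝ}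
    (hE : ∀ s, |s - z.re| ≤ |z.im| → |E s| ≤ δ) (v : ℂ) :
    |meanDeriv E z v| ≤ 2 * δ / |z.im| * (2 * ‖v‖) := by
  have hy : 0 < |z.im| := abs_pos.2 hz
  have h0 := hE z.re (by simp)
  have h1 := hE (z.re + z.im) (by simp)
  have hδ : 0 ≤ δ := (abs_nonneg _).trans h0
  have h2 : |mean E z| ≤ δ := by
    have := intervalIntegral.norm_integral_le_of_norm_le_const (a := (0 : ℝ)) (b := 1) (C := δ)
      (f := fun t => E (z.re + z.im * t)) (fun t ht => hE _ (by
        rw [Set.uIoc_of_le zero_le_one] at ht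
        rw [add_sub_cancel_left, abs_mul, abs_of_pos ht.1]
        nlinarith [ht.2]))
    simpa [mean] using this
  rw [meanDeriv_apply]
  refine (abs_add_le _ _).trans ?_
  rw [abs_mul, abs_mul, abs_div, abs_div]
  have b1 : |E (z.re + z.im) - E z.re| ≤ 2 * δ := (abs_sub _ _).trans (by linarith)
  have b2 : |E (z.re + z.im) - mean E z| ≤ 2 * δ := (abs_sub _ _).trans (by linarith)
  have n1 := Complex.abs_re_le_norm v
  have n2 := Complex.abs_im_le_norm v
  have i1 : |E (z.re + z.im) - E z.re| / |z.im| * |v.re| ≤ 2 * δ / |z.im| * ‖v‖ := by gcongr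
  have i2 : |E (z.re + z.im) - mean E z| / |z.im| * |v.im| ≤ 2 * δ / |z.im| * ‖v‖ := by gcongr
  linarith

/-- The coefficients of the derivative are differences of values and means of E over [x - |y|, x +
|y|], divided by y, so a bound for E on that interval suffices. -/
theorem norm_beurlingAhlforsDeriv_le {E : ℝ → ℝ} {z : ℂ} (hz : z.im ≠ 0) {δ : ℝ}
    (hE : ∀ s, |s - z.re| ≤ |z.im| → |E s| ≤ δ) (v : ℂ) :
    ‖beurlingAhlforsDeriv E z v‖ ≤ 8 * δ / |z.im| * ‖v‖ := by
  have h1 := abs_meanDeriv_le hz hE v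
  have h2 := abs_meanDeriv_le (E := E) (z := (starRingEnd ℂ) z) (by simpa using hz) (δ := δ)
    (by simpa using hE) ((starRingEnd ℂ) v)
  simp only [Complex.conj_im, abs_neg, RCLike.norm_conj] at h2
  refine (Complex.norm_le_abs_re_add_abs_im _).trans ?_
  rw [beurlingAhlforsDeriv_re, beurlingAhlforsDeriv_im, abs_div, abs_div, abs_two]
  have h3 := abs_add_le (meanDeriv E z v) (meanDeriv E ((starRingEnd ℂ) z) ((starRingEnd ℂ) v))
  have h4 := abs_sub (meanDeriv E z v) (meanDeriv E ((starRingEnd ℂ) z) ((starRingEnd ℂ) v))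
  have e : 8 * δ / |z.im| * ‖v‖ = 2 * (2 * δ / |z.im| * (2 * ‖v‖)) := by ring
  rw [e]
  linarith

theorem meanDeriv_sub_affine {H : ℝ → ℝ} (hG : Continuous G) (hH : Continuous H) (a b : ℝ)
    (z v : ℂ) : meanDeriv (fun s => H s - (a + b * G s)) z v =
      meanDeriv H z v - b * meanDeriv G z v := by
  have hmean : mean (fun s => H s - (a + b * G s)) z = mean H z - (a + b * mean G z) := by
    simp only [mean]
    rw [intervalIntegral.integral_sub (by apply Continuous.intervalIntegrable; fun_prop)
      (by apply Continuous.intervalIntegrable; fun_prop),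
      intervalIntegral.integral_add (by simp) (by apply Continuous.intervalIntegrable; fun_prop)]
    simp
  rw [meanDeriv_apply, meanDeriv_apply, meanDeriv_apply, hmean]
  ring

/-- The derivative is linear in the boundary function and only involves differences, so the additive
constant a disappears. -/
theorem beurlingAhlforsDeriv_sub_affine {H : ℝ → ℝ} (hG : Continuous G) (hH : Continuous H)
    (a b : ℝ) (z v : ℂ) : beurlingAhlforsDeriv (fun s => H s - (a + b * G s)) z v =
      beurlingAhlforsDeriv H z v - b * beurlingAhlforsDeriv G z v := by
  apply Complex.ext
  · simp [beurlingAhlforsDeriv_re, meanDeriv_sub_affine hG hH]; ring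
  · simp [beurlingAhlforsDeriv_im, meanDeriv_sub_affine hG hH]; ring

/-- If `K` is almost symmetric at small scales, then the derivatives at `z` of the extensions of
`K ∘ G` and of `G` are almost proportional. -/
theorem exists_norm_beurlingAhlforsDeriv_sub_le (hG : Continuous G) (hm : StrictMono G) {M : ℝ}
    (hM : 0 < M) (hqs : Quasisymmetric M G) {K : ℝ → ℝ} (hKc : Continuous K) (hK : StrictMono K)
    {e d : ℝ} (he0 : 0 ≤ e) (he : e ≤ 1) (h : QuasisymmetricBelow d (1 + e) K) {z : ℂ}
    (hz : z.im ≠ 0) (hzd : G (z.re + |z.im|) - G (z.re - |z.im|) < d) :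
    ∃ b : ℝ, 0 < b ∧ ∀ v, ‖beurlingAhlforsDeriv (fun s => K (G s)) z v -
        b * beurlingAhlforsDeriv G z v‖ ≤
      96 * (1 + M) ^ 2 * e * ‖b * beurlingAhlforsDeriv G z v‖ := by
  have hy : 0 < |z.im| := abs_pos.2 hz
  set p := G (z.re - |z.im|) with hp
  set l := G (z.re + |z.im|) - G (z.re - |z.im|) with hl
  have hl0 : 0 < l := sub_pos.2 (hm (by linarith))
  set D := K (p + l) - K p with hD
  have hD0 : 0 < D := sub_pos.2 (hK (by linarith))
  -- The factor is the slope of the chord of K over [p, p + l], the image under G of [x - |y|, x +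
  -- |y|].
  refine ⟨D / l, by positivity, fun v => ?_⟩
  have hE : ∀ s, |s - z.re| ≤ |z.im| →
      |K (G s) - ((K p - D / l * p) + D / l * G s)| ≤ 3 * e * D := by
    intro s hs
    obtain ⟨s1, s2⟩ := abs_le.1 hs
    have g1 : p ≤ G s := hm.monotone (by linarith)
    have g2 : G s ≤ p + l := by
      have : p + l = G (z.re + |z.im|) := by rw [hl]; ring
      rw [this]; exact hm.monotone (by linarith)
    have := h.abs_sub_affine_le hK.monotone he0 he (p := p) (l := l) (t := (G s - p) / l) hl0 hzd
      (div_nonneg (by linarith) hl0.le) (by rw [div_le_one hl0]; linarith)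
    have e1 : p + (G s - p) / l * l = G s := by field_simp; ring
    rw [e1, ← hD] at this
    convert this using 2
    field_simp
    ring
  have h1 := norm_beurlingAhlforsDeriv_le hz hE v
  rw [beurlingAhlforsDeriv_sub_affine hG (by fun_prop)] at h1
  refine h1.trans ?_
  have h2 := le_norm_beurlingAhlforsDeriv hG hm hM hqs hz v
  rw [← hp, ← hl] at h2
  rw [norm_mul, Complex.norm_real, Real.norm_of_nonneg (by positivity)]
  -- The constant is 8 · 3 · 4: the upper bound for the derivative, the error of affine
  -- approximation, and the lower bound 1/(4(1 + M)²) for the derivative of the extension of G.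
  calc 8 * (3 * e * D) / |z.im| * ‖v‖
      = 96 * (1 + M) ^ 2 * e * (D / l * (1 / (4 * (1 + M) ^ 2) * (l / |z.im|) * ‖v‖)) := by
        field_simp; ring
    _ ≤ _ := by gcongr

theorem beurlingAhlforsDeriv_injective (hG : Continuous G) (hm : StrictMono G) {M : ℝ} (hM : 0 < M)
    (hqs : Quasisymmetric M G) {z : ℂ} (hz : z.im ≠ 0) :
    Function.Injective (beurlingAhlforsDeriv G z) := by
  rw [injective_iff_map_eq_zero]
  intro v hv
  have h := le_norm_beurlingAhlforsDeriv hG hm hM hqs hz v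
  rw [hv, norm_zero] at h
  have hy : 0 < |z.im| := abs_pos.2 hz
  have hl0 : 0 < G (z.re + |z.im|) - G (z.re - |z.im|) := sub_pos.2 (hm (by linarith))
  have hc : 0 < (1 / (4 * (1 + M) ^ 2)) * ((G (z.re + |z.im|) - G (z.re - |z.im|)) / |z.im|) := by
    positivity
  rw [← norm_le_zero_iff]
  by_contra! hv0
  have := mul_pos hc hv0
  linarith

/-- The derivative of the extension as an isomorphism. -/
theorem exists_equiv_beurlingAhlforsDeriv (hG : Continuous G) (hm : StrictMono G) {M : ℝ}
    (hM : 0 < M) (hqs : Quasisymmetric M G) {z : ℂ} (hz : z.im ≠ 0) :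
    ∃ L : ℂ ≃L[ℝ] ℂ, (L : ℂ →L[ℝ] ℂ) = beurlingAhlforsDeriv G z := by
  refine ⟨(LinearEquiv.ofInjectiveEndo (beurlingAhlforsDeriv G z : ℂ →ₗ[ℝ] ℂ)
    (beurlingAhlforsDeriv_injective hG hm hM hqs hz)).toContinuousLinearEquiv, ?_⟩
  rfl

end estimates

/-- The image of the upper half plane is open by the inverse function theorem and relatively closed
in the half plane by properness, so connectedness gives the whole half plane. Conjugation and
surjectivity of G handle the rest. -/
theorem beurlingAhlfors_surjective {G : ℝ → ℝ} (hG : Continuous G) (hm : StrictMono G) {M : ℝ}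
    (hM : 0 < M) (hqs : Quasisymmetric M G) (h1 : ∀ x, G (x + 1) = G x + 1) :
    Function.Surjective (beurlingAhlfors G) := by
  have hclosed : IsClosedMap (beurlingAhlfors G) := (isProperMap_iff_tendsto_cocompact.2
    ⟨continuous_beurlingAhlfors hG, tendsto_beurlingAhlfors_cocompact hG h1⟩).isClosedMap
  set U : Set ℂ := {z | 0 < z.im} with hU
  have hUo : IsOpen U := isOpen_lt continuous_const Complex.continuous_im
  have hsub : U ⊆ beurlingAhlfors G '' U := by
    refine (convex_halfSpace_im_gt 0).isPreconnected.subset_of_closure_inter_subset ?_ ?_ ?_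
    · rw [isOpen_iff_mem_nhds]
      rintro _ ⟨z, hz, rfl⟩
      have hz0 : z.im ≠ 0 := ne_of_gt hz
      obtain ⟨L, hL⟩ := exists_equiv_beurlingAhlforsDeriv hG hm hM hqs hz0
      have := hasStrictFDerivAt_beurlingAhlfors hG hz0
      rw [← hL] at this
      rw [← this.map_nhds_eq_of_equiv]
      exact Filter.image_mem_map (hUo.mem_nhds hz)
    · exact ⟨beurlingAhlfors G Complex.I, beurlingAhlfors_im_pos hG hm (by simp),
        Complex.I, by simp [hU], rfl⟩
    · rintro w ⟨hw, hwU⟩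
      obtain ⟨z, rfl⟩ := hclosed.isClosed_range.closure_subset_iff.2 (Set.image_subset_range _ _) hw
      exact ⟨z, (beurlingAhlfors_im_pos_iff hG hm).1 hwU, rfl⟩
  intro w
  rcases lt_trichotomy w.im 0 with hw | hw | hw
  · obtain ⟨z, -, hz⟩ := hsub (show (starRingEnd ℂ) w ∈ U by simpa [hU] using hw)
    exact ⟨(starRingEnd ℂ) z, by rw [beurlingAhlfors_conj, hz, Complex.conj_conj]⟩
  · obtain ⟨x, hx⟩ := surjective_of_add_one hG h1 w.re
    refine ⟨x, ?_⟩
    rw [beurlingAhlfors_ofReal, hx]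
    apply Complex.ext <;> simp [hw]
  · obtain ⟨z, -, hz⟩ := hsub hw
    exact ⟨z, hz⟩

theorem exists_homeomorph_beurlingAhlfors {G : ℝ → ℝ} (hG : Continuous G) (hm : StrictMono G)
    {M : ℝ} (hM : 0 < M) (hqs : Quasisymmetric M G) (h1 : ∀ x, G (x + 1) = G x + 1) :
    ∃ Φ : ℂ ≃ₜ ℂ, ∀ z, Φ z = beurlingAhlfors G z :=
  ⟨(Equiv.ofBijective _ ⟨beurlingAhlfors_injective hG hm,
    beurlingAhlfors_surjective hG hm hM hqs h1⟩).toHomeomorphOfContinuousClosed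
    (continuous_beurlingAhlfors hG) (isProperMap_iff_tendsto_cocompact.2
    ⟨continuous_beurlingAhlfors hG, tendsto_beurlingAhlfors_cocompact hG h1⟩).isClosedMap,
    fun _ => rfl⟩

/-! ### Almost conformal linear maps -/

/-- The real linear map `T` is a perturbation of a complex linear isomorphism, of relative
size `η`. -/
def NearConformal (η : ℝ) (T : ℂ →L[ℝ] ℂ) : Prop :=
  ∃ c : ℂ, c ≠ 0 ∧ ∀ v : ℂ, ‖T v - c * v‖ ≤ η * ‖c * v‖

theorem NearConformal.mono {η η' : ℝ} {T : ℂ →L[ℝ] ℂ} (h : NearConformal η T) (hη : η ≤ η') :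
    NearConformal η' T := by
  obtain ⟨c, hc, h⟩ := h
  exact ⟨c, hc, fun v => (h v).trans (by gcongr)⟩

theorem NearConformal.mul_comp_mul {η : ℝ} {T T' : ℂ →L[ℝ] ℂ} (h : NearConformal η T) {a b : ℂ}
    (ha : a ≠ 0) (hb : b ≠ 0) (hT' : ∀ v, T' v = a * T (b * v)) : NearConformal η T' := by
  obtain ⟨c, hc, h⟩ := h
  refine ⟨a * c * b, by simp [ha, hb, hc], fun v => ?_⟩
  have := mul_le_mul_of_nonneg_left (h (b * v)) (norm_nonneg a)
  have e1 : T' v - a * c * b * v = a * (T (b * v) - c * (b * v)) := by rw [hT']; ring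
  have e2 : a * c * b * v = a * (c * (b * v)) := by ring
  rw [e1, e2, norm_mul, norm_mul a]
  linarith

/-- The defect X = ‖v - c T' v‖ satisfies X ≤ η(‖v‖ + X); since η ≤ 1/4 the term ηX is absorbed, at
the cost of the factor 2. -/
theorem NearConformal.of_rightInverse {η : ℝ} {T T' : ℂ →L[ℝ] ℂ} (h : NearConformal η T)
    (hη0 : 0 ≤ η) (hη : η ≤ 1 / 4) (hT' : ∀ v, T (T' v) = v) : NearConformal (2 * η) T' := by
  obtain ⟨c, hc, h⟩ := h
  refine ⟨c⁻¹, inv_ne_zero hc, fun v => ?_⟩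
  have h1 := h (T' v)
  rw [hT'] at h1
  have hc' : 0 < ‖c‖ := norm_pos_iff.2 hc
  have h2 : ‖c * T' v‖ ≤ ‖v‖ + ‖v - c * T' v‖ := by
    have := norm_sub_le v (v - c * T' v)
    rwa [sub_sub_cancel] at this
  have h3 : ‖v - c * T' v‖ ≤ 2 * η * ‖v‖ := by
    have n1 := norm_nonneg (v - c * T' v)
    have n2 := norm_nonneg v
    nlinarith [mul_nonneg hη0 n1, mul_nonneg hη0 n2]
  have e : T' v - c⁻¹ * v = -(c⁻¹ * (v - c * T' v)) := by field_simp; ring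
  rw [e, norm_neg, norm_mul, norm_mul]
  have := mul_le_mul_of_nonneg_left h3 (norm_nonneg c⁻¹)
  linarith

/-- The coefficient of `v` in the real linear map `T`. -/
def wirtinger (T : ℂ →L[ℝ] ℂ) : ℂ := (T 1 - Complex.I * T Complex.I) / 2

/-- The coefficient of the conjugate of `v` in the real linear map `T`. -/
def wirtingerBar (T : ℂ →L[ℝ] ℂ) : ℂ := (T 1 + Complex.I * T Complex.I) / 2

theorem NearConformal.wirtinger_bounds {η : ℝ} {T : ℂ →L[ℝ] ℂ} (h : NearConformal η T)
    (hη0 : 0 ≤ η) (hη : η ≤ 1 / 4) :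
    wirtinger T ≠ 0 ∧ ‖wirtingerBar T‖ ≤ 2 * η * ‖wirtinger T‖ := by
  obtain ⟨c, hc, h⟩ := h
  have hc' : 0 < ‖c‖ := norm_pos_iff.2 hc
  have h1 : ‖T 1 - c‖ ≤ η * ‖c‖ := by simpa using h 1
  have h2 : ‖Complex.I * (T Complex.I - c * Complex.I)‖ ≤ η * ‖c‖ := by simpa using h Complex.I
  have hp : ‖c‖ ≤ ‖wirtinger T‖ + η * ‖c‖ := by
    have e : c = wirtinger T - ((T 1 - c) - Complex.I * (T Complex.I - c * Complex.I)) / 2 := by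
      rw [wirtinger]; linear_combination (c / 2) * Complex.I_sq
    have t1 := norm_sub_le (wirtinger T)
      (((T 1 - c) - Complex.I * (T Complex.I - c * Complex.I)) / 2)
    rw [← e, norm_div, Complex.norm_two] at t1
    have t2 := norm_sub_le (T 1 - c) (Complex.I * (T Complex.I - c * Complex.I))
    linarith
  have hq : ‖wirtingerBar T‖ ≤ η * ‖c‖ := by
    have e : wirtingerBar T = ((T 1 - c) + Complex.I * (T Complex.I - c * Complex.I)) / 2 := by
      rw [wirtingerBar]; linear_combination (c / 2) * Complex.I_sq
    rw [e, norm_div, Complex.norm_two]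
    have t2 := norm_add_le (T 1 - c) (Complex.I * (T Complex.I - c * Complex.I))
    linarith
  have hp2 : 3 / 4 * ‖c‖ ≤ ‖wirtinger T‖ := by nlinarith
  refine ⟨norm_pos_iff.1 (by linarith), hq.trans ?_⟩
  nlinarith

theorem det_eq_re_mul_im_sub (T : ℂ →L[ℝ] ℂ) :
    T.det = (T 1).re * (T Complex.I).im - (T Complex.I).re * (T 1).im := by
  rw [ContinuousLinearMap.det, ← LinearMap.det_toMatrix Complex.basisOneI, Matrix.det_fin_two]
  simp [LinearMap.toMatrix_apply]

/-- Here ‖T v‖ ≤ 5‖c‖/4 while the Jacobian is at least ‖c‖²/4. A bound linear in the Jacobian is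
what lets the area formula control the derivative. -/
theorem NearConformal.norm_apply_le {η : ℝ} {T : ℂ →L[ℝ] ℂ} (h : NearConformal η T)
    (hη : η ≤ 1 / 4) {v : ℂ} (hv : ‖v‖ = 1) : ‖T v‖ ≤ 1 + 8 * |T.det| := by
  obtain ⟨c, hc, h⟩ := h
  have hTv : ‖T v‖ ≤ 5 / 4 * ‖c‖ := by
    have h1 := h v
    rw [norm_mul, hv, mul_one] at h1
    have h2 := norm_sub_norm_le (T v) (c * v)
    rw [norm_mul, hv, mul_one] at h2
    nlinarith [norm_nonneg c]
  have hdet : 1 / 4 * ‖c‖ ^ 2 ≤ T.det := by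
    have h1 : ‖T 1 - c‖ ≤ 1 / 4 * ‖c‖ :=
      (by simpa using h 1 : ‖T 1 - c‖ ≤ η * ‖c‖).trans (by gcongr)
    have h2 : ‖T Complex.I - c * Complex.I‖ ≤ 1 / 4 * ‖c‖ :=
      (by simpa using h Complex.I : ‖T Complex.I - c * Complex.I‖ ≤ η * ‖c‖).trans (by gcongr)
    have s1 : (‖T 1 - c‖) ^ 2 ≤ (1 / 4 * ‖c‖) ^ 2 := by gcongr
    have s2 : (‖T Complex.I - c * Complex.I‖) ^ 2 ≤ (1 / 4 * ‖c‖) ^ 2 := by gcongr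
    have nc : ‖c‖ ^ 2 = c.re ^ 2 + c.im ^ 2 := by
      rw [← Complex.normSq_eq_norm_sq, Complex.normSq_apply]; ring
    rw [mul_pow, nc, ← Complex.normSq_eq_norm_sq, Complex.normSq_apply] at s1 s2
    rw [det_eq_re_mul_im_sub, nc]
    simp at s1 s2
    -- The Jacobian is quadratic in the deviations of T 1 from c and of T I from c I; these squares
    -- certify its lower bound.
    nlinarith [sq_nonneg (c.re + 4 * ((T 1).re - c.re)), sq_nonneg (c.im + 4 * ((T 1).im - c.im)),
      sq_nonneg (c.re + 4 * ((T Complex.I).im - c.re)),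
      sq_nonneg (c.im - 4 * ((T Complex.I).re + c.im)),
      sq_nonneg ((T 1).re - c.re + ((T Complex.I).im - c.re)),
      sq_nonneg ((T 1).im - c.im - ((T Complex.I).re + c.im))]
  have := le_abs_self T.det
  nlinarith [sq_nonneg (5 / 8 * ‖c‖ - 1)]

/-! ### Distributional derivatives of maps which are differentiable off a small set -/

theorem integral_eq_zero_of_hasDerivAt_off_countable {u u' : ℝ → ℂ} {s : Set ℝ} (hu : Continuous u)
    (hsupp : HasCompactSupport u) (hs : s.Countable) (hd : ∀ x, x ∉ s → HasDerivAt u (u' x) x)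
    (hi : Integrable u') : ∫ x, u' x = 0 := by
  have h1 := intervalIntegral_tendsto_integral hi Filter.tendsto_neg_atTop_atBot Filter.tendsto_id
  have h2 : ∀ R : ℝ, ∫ x in (-R)..(id R), u' x = u R - u (-R) := fun R =>
    integral_eq_of_hasDerivAt_off_countable u u' hs hu.continuousOn
      (fun x hx => hd x hx.2) hi.intervalIntegrable
  have h0 := hsupp.is_zero_at_infty
  have h3 : Filter.Tendsto (fun R : ℝ => u R - u (-R)) Filter.atTop (𝓝 (0 - 0)) :=
    (h0.mono_left atTop_le_cocompact).sub
      ((h0.mono_left atBot_le_cocompact).comp Filter.tendsto_neg_atTop_atBot)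
  simp only [h2] at h1
  rw [tendsto_nhds_unique h1 h3, sub_zero]

/-- Fubini reduces the claim to horizontal lines. On almost every one the fundamental theorem of
calculus, which tolerates a countable exceptional set, applies to a compactly supported function. -/
theorem integral_fderiv_one_eq_zero {ψ : ℂ → ℂ} {ψ' : ℂ → ℂ →L[ℝ] ℂ} {S : Set ℂ}
    (hψ : Continuous ψ) (hsupp : HasCompactSupport ψ)
    (hS : ∀ y : ℝ, {x : ℝ | (⟨x, y⟩ : ℂ) ∈ S}.Countable)
    (hd : ∀ z, z ∉ S → HasFDerivAt ψ (ψ' z) z) (hi : Integrable (fun z => ψ' z 1)) :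
    ∫ z, ψ' z 1 = 0 := by
  have mp := Complex.volume_preserving_equiv_real_prod.symm
  rw [← mp.integral_comp Complex.measurableEquivRealProd.symm.measurableEmbedding]
  rw [← mp.integrable_comp_emb Complex.measurableEquivRealProd.symm.measurableEmbedding] at hi
  rw [Measure.volume_eq_prod] at hi ⊢
  change Integrable (fun x => ψ' (Complex.measurableEquivRealProd.symm x) 1) _ at hi
  rw [integral_prod_symm _ hi]
  refine integral_eq_zero_of_ae ?_
  filter_upwards [hi.prod_left_ae] with y hy
  have hγ : ∀ x : ℝ, (⟨x, y⟩ : ℂ) = (x : ℂ) + (y : ℂ) * Complex.I := fun x => by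
    apply Complex.ext <;> simp
  have hγe : IsClosedEmbedding (fun x : ℝ => (⟨x, y⟩ : ℂ)) := by
    have : (fun x : ℝ => (⟨x, y⟩ : ℂ)) =
        (fun w : ℂ => w + (y : ℂ) * Complex.I) ∘ (fun x : ℝ => (x : ℂ)) := by
      funext x; exact hγ x
    rw [this]
    exact (Homeomorph.addRight ((y : ℂ) * Complex.I)).isClosedEmbedding.comp
      Complex.isometry_ofReal.isClosedEmbedding
  refine integral_eq_zero_of_hasDerivAt_off_countable (u := fun x => ψ ⟨x, y⟩)
    (hψ.comp hγe.continuous) (hsupp.comp_isClosedEmbedding hγe) (hS y) (fun x hx => ?_) hy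
  have h1 : HasDerivAt (fun x : ℝ => (⟨x, y⟩ : ℂ)) 1 x := by
    simp only [hγ]
    exact (Complex.ofRealCLM.hasDerivAt).add_const _
  exact (hd ⟨x, y⟩ hx).comp_hasDerivAt x h1

theorem integral_fderiv_I_eq_zero {ψ : ℂ → ℂ} {ψ' : ℂ → ℂ →L[ℝ] ℂ} {S : Set ℂ}
    (hψ : Continuous ψ) (hsupp : HasCompactSupport ψ)
    (hS : ∀ x : ℝ, {y : ℝ | (⟨x, y⟩ : ℂ) ∈ S}.Countable)
    (hd : ∀ z, z ∉ S → HasFDerivAt ψ (ψ' z) z) (hi : Integrable (fun z => ψ' z Complex.I)) :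
    ∫ z, ψ' z Complex.I = 0 := by
  have mp := Complex.volume_preserving_equiv_real_prod.symm
  rw [← mp.integral_comp Complex.measurableEquivRealProd.symm.measurableEmbedding]
  rw [← mp.integrable_comp_emb Complex.measurableEquivRealProd.symm.measurableEmbedding] at hi
  rw [Measure.volume_eq_prod] at hi ⊢
  change Integrable (fun x => ψ' (Complex.measurableEquivRealProd.symm x) Complex.I) _ at hi
  rw [integral_prod _ hi]
  refine integral_eq_zero_of_ae ?_
  filter_upwards [hi.prod_right_ae] with x hx
  have hγ : ∀ y : ℝ, (⟨x, y⟩ : ℂ) = (x : ℂ) + (y : ℂ) * Complex.I := fun y => by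
    apply Complex.ext <;> simp
  have hγe : IsClosedEmbedding (fun y : ℝ => (⟨x, y⟩ : ℂ)) := by
    have : (fun y : ℝ => (⟨x, y⟩ : ℂ)) =
        (fun w : ℂ => (x : ℂ) + w) ∘ (fun w : ℂ => w * Complex.I) ∘ (fun y : ℝ => (y : ℂ)) := by
      funext y; exact hγ y
    rw [this]
    exact (Homeomorph.addLeft (x : ℂ)).isClosedEmbedding.comp
      ((Homeomorph.mulRight₀ Complex.I Complex.I_ne_zero).isClosedEmbedding.comp
      Complex.isometry_ofReal.isClosedEmbedding)
  refine integral_eq_zero_of_hasDerivAt_off_countable (u := fun y => ψ ⟨x, y⟩)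
    (hψ.comp hγe.continuous) (hsupp.comp_isClosedEmbedding hγe) (hS x) (fun y hy' => ?_) hx
  have h1 : HasDerivAt (fun y : ℝ => (⟨x, y⟩ : ℂ)) Complex.I y := by
    simp only [hγ]
    simpa using ((Complex.ofRealCLM.hasDerivAt (x := y)).mul_const Complex.I).const_add (x : ℂ)
  exact (hd ⟨x, y⟩ hy').comp_hasDerivAt y h1

/-- Every horizontal and every vertical line meets `S` in a countable set. -/
structure CountableOnLines (S : Set ℂ) : Prop where
  horizontal : ∀ y : ℝ, {x : ℝ | (⟨x, y⟩ : ℂ) ∈ S}.Countable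
  vertical : ∀ x : ℝ, {y : ℝ | (⟨x, y⟩ : ℂ) ∈ S}.Countable

/-- The product φ G, extended by zero, is continuous with compact support and differentiable off S;
the vanishing of the integral of its derivative is the weak identity. -/
theorem hasWeakDirDeriv_of_hasFDerivAt {Ω S : Set ℂ} (hΩ : IsOpen Ω) (hS : CountableOnLines S)
    {G : ℂ → ℂ} (hG : ContinuousOn G Ω) {G' : ℂ → ℂ →L[ℝ] ℂ}
    (hd : ∀ z ∈ Ω \ S, HasFDerivAt G (G' z) z) {v : ℂ} (hv : v = 1 ∨ v = Complex.I)
    (hi : LocallyIntegrableOn (fun z => G' z v) Ω) :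
    HasWeakDirDeriv Ω G v (fun z => G' z v) := by
  refine ⟨hG.locallyIntegrableOn hΩ.measurableSet, hi, fun φ hφ hφc hφs => ?_⟩
  have hφ0 : ∀ z, z ∉ Ω → φ z = 0 := fun z hz => image_eq_zero_of_notMem_tsupport fun h => hz (hφs h)
  have hdφ : Continuous (fun z => fderiv ℝ φ z v) :=
    (hφ.continuous_fderiv (by simp)).clm_apply continuous_const
  have hdsub : tsupport (fun z => fderiv ℝ φ z v) ⊆ tsupport φ := tsupport_fderiv_apply_subset ℝ v
  have hdφ0 : ∀ z, z ∉ Ω → fderiv ℝ φ z v = 0 := fun z hz =>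
    image_eq_zero_of_notMem_tsupport (f := fun z => fderiv ℝ φ z v) fun h => hz (hφs (hdsub h))
  rw [setIntegral_eq_integral_of_forall_compl_eq_zero (fun z hz => by rw [hdφ0 z hz, zero_smul]),
    setIntegral_eq_integral_of_forall_compl_eq_zero (fun z hz => by rw [hφ0 z hz, zero_smul]),
    ← add_eq_zero_iff_eq_neg]
  -- the two integrands
  have c1 : Continuous (fun z => (fderiv ℝ φ z v) • G z) := by
    refine (hdφ.continuousOn.smul hG).continuous_of_tsupport_subset hΩ ?_
    exact ((tsupport_smul_subset_left _ _).trans hdsub).trans hφs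
  have s1 : HasCompactSupport (fun z => (fderiv ℝ φ z v) • G z) :=
    (hφc.mono' ((subset_tsupport _).trans hdsub)).smul_right
  have i1 := c1.integrable_of_hasCompactSupport (μ := volume) s1
  have i2 : Integrable (fun z => φ z • G' z v) := by
    rw [← integrableOn_iff_integrable_of_support_subset (s := tsupport φ)
      (fun z hz => subset_tsupport _ (fun h => hz (by simp [h])))]
    exact ((hi.mono_set hφs).integrableOn_isCompact hφc).continuousOn_smul
      hφ.continuous.continuousOn hφc
  rw [← integral_add i1 i2]
  -- the product
  have cψ : Continuous (fun z => φ z • G z) :=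
    (hφ.continuous.continuousOn.smul hG).continuous_of_tsupport_subset hΩ
      ((tsupport_smul_subset_left _ _).trans hφs)
  have sψ : HasCompactSupport (fun z => φ z • G z) := hφc.smul_right
  set ψ' : ℂ → ℂ →L[ℝ] ℂ := fun z => φ z • G' z + (fderiv ℝ φ z).smulRight (G z) with hψ'
  have hψd : ∀ z, z ∉ S → HasFDerivAt (fun z => φ z • G z) (ψ' z) z := by
    intro z hz
    have hφd : HasFDerivAt φ (fderiv ℝ φ z) z :=
      (hφ.differentiable (by simp) z).hasFDerivAt
    by_cases hzΩ : z ∈ Ω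
    · exact hφd.smul (hd z ⟨hzΩ, hz⟩)
    -- Outside Ω the test function vanishes near z, so the product is locally zero even though
    -- nothing is known about G there.
    · have hzt : z ∉ tsupport φ := fun h => hzΩ (hφs h)
      have e1 : φ =ᶠ[𝓝 z] 0 := notMem_tsupport_iff_eventuallyEq.1 hzt
      have e2 : ψ' z = 0 := by
        rw [hψ']
        simp only
        rw [hφ0 z hzΩ, e1.fderiv_eq]
        ext
        simp
      rw [e2]
      refine (hasFDerivAt_const (0 : ℂ) z).congr_of_eventuallyEq ?_
      filter_upwards [e1] with w hw
      simp [hw]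
  have hval : ∀ w z, ψ' z w = (fderiv ℝ φ z w) • G z + φ z • G' z w := by
    intro w z
    simp [hψ', add_comm]
  have hint : Integrable (fun z => ψ' z v) := by
    simp only [hval]
    exact i1.add i2
  simp only [← hval]
  rcases hv with rfl | rfl
  · exact integral_fderiv_one_eq_zero cψ sψ hS.horizontal hψd hint
  · exact integral_fderiv_I_eq_zero cψ sψ hS.vertical hψd hint

/-! ### A criterion of quasiconformality -/

/-- By injectivity the integral of the Jacobian over K \ S is the area of its image, which lies in
the compact set G(K); near conformality bounds the derivative by the Jacobian. -/
theorem locallyIntegrableOn_fderiv_apply {Ω S : Set ℂ} (hΩ : IsOpen Ω) (hSc : IsClosed S)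
    (hS0 : volume S = 0) {G : ℂ → ℂ} (hG : ContinuousOn G Ω) (hinj : Set.InjOn G Ω) {η : ℝ}
    (hη : η ≤ 1 / 4)
    (hd : ∀ z ∈ Ω \ S, DifferentiableAt ℝ G z ∧ NearConformal η (fderiv ℝ G z)) {v : ℂ}
    (hv : ‖v‖ = 1) : LocallyIntegrableOn (fun z => fderiv ℝ G z v) Ω := by
  rw [locallyIntegrableOn_iff hΩ.isLocallyClosed]
  intro K hKΩ hK
  rw [← integrableOn_congr_set_ae (sdiff_null_ae_eq_self hS0)]
  have hm : MeasurableSet (K \ S) := hK.measurableSet.diff hSc.measurableSet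
  have hdet : IntegrableOn (fun z => |(fderiv ℝ G z).det|) (K \ S) := by
    have := (integrableOn_image_iff_integrableOn_abs_det_fderiv_smul (f := G) (f' := fderiv ℝ G)
      volume hm (fun z hz => (hd z ⟨hKΩ hz.1, hz.2⟩).1.hasFDerivAt.hasFDerivWithinAt)
      (hinj.mono (Set.sdiff_subset.trans hKΩ)) (fun _ => (1 : ℝ))).1
    simp only [smul_eq_mul, mul_one] at this
    refine this (integrableOn_const ?_)
    refine ne_top_of_le_ne_top (hK.image_of_continuousOn (hG.mono hKΩ)).measure_lt_top.ne
      (measure_mono (Set.image_mono Set.sdiff_subset))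
  have hone : IntegrableOn (fun _ => (1 : ℝ)) (K \ S) := integrableOn_const
    (ne_top_of_le_ne_top hK.measure_lt_top.ne (measure_mono Set.sdiff_subset))
  refine Integrable.mono' (hone.add (hdet.const_mul 8))
    (measurable_fderiv_apply_const ℝ G v).aestronglyMeasurable ?_
  filter_upwards [ae_restrict_mem hm] with z hz
  exact (hd z ⟨hKΩ hz.1, hz.2⟩).2.norm_apply_le hη hv

/-- An injective continuous map with almost conformal derivatives off a small closed set has
distributional derivatives, which are close to those of a conformal map. -/
theorem exists_hasWeakWirtinger {Ω S : Set ℂ} (hΩ : IsOpen Ω) (hSc : IsClosed S)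
    (hS0 : volume S = 0) (hS : CountableOnLines S) {G : ℂ → ℂ} (hG : ContinuousOn G Ω)
    (hinj : Set.InjOn G Ω) {η : ℝ} (hη0 : 0 ≤ η) (hη : η ≤ 1 / 4)
    (hd : ∀ z ∈ Ω \ S, ∃ T, HasFDerivAt G T z ∧ NearConformal η T) :
    ∃ p q : ℂ → ℂ, HasWeakWirtinger Ω G p q ∧
      ∀ᵐ z ∂(volume.restrict Ω), p z ≠ 0 ∧ ‖q z‖ ≤ 2 * η * ‖p z‖ := by
  have hd' : ∀ z ∈ Ω \ S, DifferentiableAt ℝ G z ∧ NearConformal η (fderiv ℝ G z) := by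
    intro z hz
    obtain ⟨T, hT, hTn⟩ := hd z hz
    exact ⟨hT.differentiableAt, by rwa [hT.fderiv]⟩
  refine ⟨fun z => wirtinger (fderiv ℝ G z), fun z => wirtingerBar (fderiv ℝ G z), ⟨?_, ?_⟩, ?_⟩
  · have e : (fun z => wirtinger (fderiv ℝ G z) + wirtingerBar (fderiv ℝ G z)) =
        fun z => fderiv ℝ G z 1 := by
      funext z; rw [wirtinger, wirtingerBar]; ring
    rw [e]
    exact hasWeakDirDeriv_of_hasFDerivAt hΩ hS hG (fun z hz => (hd' z hz).1.hasFDerivAt)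
      (Or.inl rfl) (locallyIntegrableOn_fderiv_apply hΩ hSc hS0 hG hinj hη hd' (by simp))
  · have e : (fun z => Complex.I * (wirtinger (fderiv ℝ G z) - wirtingerBar (fderiv ℝ G z))) =
        fun z => fderiv ℝ G z Complex.I := by
      funext z; rw [wirtinger, wirtingerBar]
      linear_combination (-fderiv ℝ G z Complex.I) * Complex.I_sq
    rw [e]
    exact hasWeakDirDeriv_of_hasFDerivAt hΩ hS hG (fun z hz => (hd' z hz).1.hasFDerivAt)
      (Or.inr rfl) (locallyIntegrableOn_fderiv_apply hΩ hSc hS0 hG hinj hη hd' (by simp))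
  · have hnull : ∀ᵐ z ∂(volume.restrict Ω), z ∉ S :=
      ae_restrict_of_ae (measure_eq_zero_iff_ae_notMem.1 hS0)
    filter_upwards [ae_restrict_mem hΩ.measurableSet, hnull] with z hz hzS
    exact (hd' z ⟨hz, hzS⟩).2.wirtinger_bounds hη0 hη

theorem isQuasiconformalOn_and_dilatationLT {Ω S : Set ℂ} (hΩ : IsOpen Ω) (hΩc : IsConnected Ω)
    (hSc : IsClosed S) (hS0 : volume S = 0) (hS : CountableOnLines S) {G : ℂ → ℂ}
    (hG : IsOpenEmbedding (fun z : Ω => G z)) {η : ℝ} (hη0 : 0 ≤ η) (hη : η ≤ 1 / 4)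
    (hd : ∀ z ∈ Ω \ S, ∃ T, HasFDerivAt G T z ∧ NearConformal η T) :
    IsQuasiconformalOn Ω G ∧ ∀ ε, 8 * η < ε → DilatationLT Ω G (1 + ε) := by
  have hGc : ContinuousOn G Ω := continuousOn_iff_continuous_domRestrict.2 hG.continuous
  have hinj : Set.InjOn G Ω := Set.injOn_iff_injective.2 hG.injective
  obtain ⟨p, q, hw, hae⟩ := exists_hasWeakWirtinger hΩ hSc hS0 hS hGc hinj hη0 hη hd
  refine ⟨⟨hΩ, hΩc, hG, p, q, hw, 2 * η, by positivity, by linarith, hae⟩, fun ε hε =>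
    ⟨p, q, hw, ?_⟩⟩
  filter_upwards [hae] with z hz
  have hp : 0 < ‖p z‖ := norm_pos_iff.2 hz.1
  have hq := hz.2
  have h1 : ‖q z‖ < ‖p z‖ := by nlinarith
  refine ⟨h1, ?_⟩
  rw [div_lt_iff₀ (by linarith)]
  -- K - 1 = 2‖q‖/(‖p‖ - ‖q‖), where ‖q‖ ≤ 2η‖p‖ and the denominator is at least ‖p‖/2; hence K - 1
  -- ≤ 8η.
  have h2 : ‖p z‖ / 2 ≤ ‖p z‖ - ‖q z‖ := by nlinarith
  nlinarith

/-! ### Multiplications in the coordinate given by a homeomorphism of the plane -/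

/-- The multiplication by `c`, conjugated by the homeomorphism `Φ`. -/
def conjMul (Φ : ℂ ≃ₜ ℂ) (c w : ℂ) : ℂ := Φ (c * Φ.symm w)

theorem conjMul_conjMul (Φ : ℂ ≃ₜ ℂ) (c c' w : ℂ) :
    conjMul Φ c (conjMul Φ c' w) = conjMul Φ (c * c') w := by
  simp [conjMul, mul_assoc]

@[simp] theorem conjMul_one (Φ : ℂ ≃ₜ ℂ) (w : ℂ) : conjMul Φ 1 w = w := by
  simp [conjMul]

theorem continuous_conjMul (Φ : ℂ ≃ₜ ℂ) (c : ℂ) : Continuous (conjMul Φ c) := by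
  unfold conjMul
  fun_prop

theorem conjMul_inv_conjMul (Φ : ℂ ≃ₜ ℂ) {c : ℂ} (hc : c ≠ 0) (w : ℂ) :
    conjMul Φ c⁻¹ (conjMul Φ c w) = w := by
  rw [conjMul_conjMul, inv_mul_cancel₀ hc, conjMul_one]

theorem conjMul_conjMul_inv (Φ : ℂ ≃ₜ ℂ) {c : ℂ} (hc : c ≠ 0) (w : ℂ) :
    conjMul Φ c (conjMul Φ c⁻¹ w) = w := by
  rw [conjMul_conjMul, mul_inv_cancel₀ hc, conjMul_one]

/-- The homeomorphism `conjMul Φ c` for a nonzero `c`. -/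
def conjMulHomeomorph (Φ : ℂ ≃ₜ ℂ) {c : ℂ} (hc : c ≠ 0) : ℂ ≃ₜ ℂ where
  toFun := conjMul Φ c
  invFun := conjMul Φ c⁻¹
  left_inv := conjMul_inv_conjMul Φ hc
  right_inv := conjMul_conjMul_inv Φ hc
  continuous_toFun := continuous_conjMul Φ c
  continuous_invFun := continuous_conjMul Φ c⁻¹

/-- `Φ` is a homeomorphism of the plane which commutes with the unit translation and with the
complex conjugation, and which conjugates the powers of the division by `m` to maps which are
uniformly almost conformal near the real line. -/
structure AsymptoticallyConformal (m : ℕ) (Φ : ℂ ≃ₜ ℂ) : Prop where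
  add_one : ∀ z, Φ (z + 1) = Φ z + 1
  conj : ∀ z, Φ ((starRingEnd ℂ) z) = (starRingEnd ℂ) (Φ z)
  im_eq_zero_iff : ∀ z, (Φ z).im = 0 ↔ z.im = 0
  near : ∀ η : ℝ, 0 < η → ∃ d : ℝ, 0 < d ∧ ∀ n : ℕ, 1 ≤ n → ∀ w : ℂ, w.im ≠ 0 → |w.im| < d →
    ∃ T, HasFDerivAt (conjMul Φ ((m : ℂ) ^ n)⁻¹) T w ∧ NearConformal η T

theorem apply_add_int {u : ℂ → ℂ} (h : ∀ z, u (z + 1) = u z + 1) (k : ℤ) (z : ℂ) :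
    u (z + k) = u z + k := by
  induction k with
  | zero => simp
  | succ k ih => push_cast at ih ⊢; rw [← add_assoc, h, ih, add_assoc]
  | pred k ih =>
    have := h (z + ((-(k : ℤ) - 1 : ℤ) : ℂ))
    push_cast at this ih ⊢
    have e : z + (-(k : ℂ) - 1) + 1 = z + -(k : ℂ) := by ring
    rw [e, ih] at this
    linear_combination -this

/-- A continuous periodic function which vanishes on the real line is small near that line. -/
theorem exists_strip {u : ℂ → ℝ} (hu : Continuous u) (hper : ∀ z, u (z + 1) = u z)
    (h0 : ∀ x : ℝ, u x = 0) {d : ℝ} (hd : 0 < d) :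
    ∃ δ : ℝ, 0 < δ ∧ ∀ z : ℂ, |z.im| < δ → |u z| < d := by
  obtain ⟨δ, hδ, hsub⟩ := ((isCompact_Icc (a := (0 : ℝ)) (b := 1)).image
    Complex.continuous_ofReal).exists_thickening_subset_open
    (isOpen_lt hu.abs continuous_const : IsOpen {z | |u z| < d}) (by
      rintro _ ⟨x, -, rfl⟩
      simpa [h0] using hd)
  refine ⟨δ, hδ, fun z hz => ?_⟩
  have hp : ∀ (k : ℤ) (z : ℂ), u (z + k) = u z := by
    intro k z
    have hP : Function.Periodic u 1 := hper
    simpa using hP.int_mul k z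
  have h1 : z + ((-⌊z.re⌋ : ℤ) : ℂ) ∈ Metric.thickening δ (Complex.ofReal '' Set.Icc 0 1) := by
    rw [Metric.mem_thickening_iff]
    refine ⟨(Int.fract z.re : ℝ), ⟨_, ⟨Int.fract_nonneg _, (Int.fract_lt_one _).le⟩, rfl⟩, ?_⟩
    rw [dist_eq_norm]
    have : z + ((-⌊z.re⌋ : ℤ) : ℂ) - ((Int.fract z.re : ℝ) : ℂ) = (z.im : ℂ) * Complex.I := by
      have := Int.self_sub_floor z.re
      apply Complex.ext <;> simp
      linarith
    rw [this]
    simpa using hz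
  have h2 : |u _| < d := hsub h1
  rwa [hp] at h2

/-! ### The Beurling–Ahlfors coordinate -/

/-- Boundedness of ε supplies the quasisymmetry constant of G, hence the coordinate Φ; the decay of
ε supplies the almost conformality near the line, uniformly in n. -/
theorem exists_asymptoticallyConformal {m : ℕ} (hm : 2 ≤ m) {f : Circle → Circle} {F : ℝ ≃ₜ ℝ}
    (hF : IsLift m f F) {ε : ℝ → ℝ} (hε : IsVanishing ε)
    (hrho : ∀ n : ℕ, 1 ≤ n → ∀ x y : ℝ, 0 < y →
      1 / (1 + ε y) ≤ rho (F.symm^[n]) x y ∧ rho (F.symm^[n]) x y ≤ 1 + ε y) :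
    ∃ Φ : ℂ ≃ₜ ℂ, AsymptoticallyConformal m Φ ∧ ∀ x : ℝ, conjMul Φ m x = F x := by
  have hm0 : (m : ℝ) ≠ 0 := by positivity
  have hmono := hF.strictMono_iterate_symm
  have hbounds : ∀ n : ℕ, 1 ≤ n → ∀ x y : ℝ, 0 < y →
      (F.symm^[n]) (x + y) - (F.symm^[n]) x ≤
        (1 + ε y) * ((F.symm^[n]) x - (F.symm^[n]) (x - y)) ∧
      (F.symm^[n]) x - (F.symm^[n]) (x - y) ≤
        (1 + ε y) * ((F.symm^[n]) (x + y) - (F.symm^[n]) x) := fun n hn x y hy =>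
    (rho_bounds_iff (hmono n) hy (by linarith [hε.pos y hy])).1 (hrho n hn x y hy)
  have hweak : ∀ n : ℕ, 1 ≤ n → ∀ x y c : ℝ, 0 < y → ε y ≤ c →
      (F.symm^[n]) (x + y) - (F.symm^[n]) x ≤
        (1 + c) * ((F.symm^[n]) x - (F.symm^[n]) (x - y)) ∧
      (F.symm^[n]) x - (F.symm^[n]) (x - y) ≤
        (1 + c) * ((F.symm^[n]) (x + y) - (F.symm^[n]) x) := by
    intro n hn x y c hy hc
    obtain ⟨h1, h2⟩ := hbounds n hn x y hy
    have p1 : 0 ≤ (F.symm^[n]) (x + y) - (F.symm^[n]) x :=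
      sub_nonneg.2 ((hmono n).monotone (by linarith))
    have p2 : 0 ≤ (F.symm^[n]) x - (F.symm^[n]) (x - y) :=
      sub_nonneg.2 ((hmono n).monotone (by linarith))
    exact ⟨h1.trans (by gcongr), h2.trans (by gcongr)⟩
  obtain ⟨C, hC⟩ := hε.bounded
  have hC0 : 0 < C := (hε.pos 1 one_pos).trans_le (hC 1 one_pos)
  set M := 1 + C with hMdef
  have hM : 1 ≤ M := by linarith
  have hM0 : 0 < M := by linarith
  obtain ⟨G, hG, hGm, hG1, hGF, hGqs⟩ := hF.exists_semiconj hm hM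
    (fun n hn x y hy => hweak n hn x y C hy (hC y hy))
  have hGn : ∀ (n : ℕ) (x : ℝ), (F.symm^[n]) (G x) = G (((m : ℝ) ^ n)⁻¹ * x) := by
    intro n
    induction n with
    | zero => simp
    | succ n ih =>
      intro x
      have : F.symm (G x) = G ((m : ℝ)⁻¹ * x) := by
        rw [Homeomorph.symm_apply_eq, ← hGF, mul_inv_cancel_left₀ hm0]
      rw [Function.iterate_succ_apply, this, ih, pow_succ, mul_inv, mul_assoc]
  obtain ⟨Φ, hΦ⟩ := exists_homeomorph_beurlingAhlfors hG hGm hM0 hGqs hG1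
  have hΦ1 : ∀ z, Φ (z + 1) = Φ z + 1 := fun z => by
    rw [hΦ, hΦ, beurlingAhlfors_add_one hG hG1]
  have hΦ0 : ∀ z, (Φ z).im = 0 ↔ z.im = 0 := fun z => by
    rw [hΦ, beurlingAhlfors_im_eq_zero_iff hG hGm]
  refine ⟨Φ, ⟨hΦ1, fun z => by rw [hΦ, hΦ, beurlingAhlfors_conj], hΦ0, fun η hη => ?_⟩,
    fun x => ?_⟩
  swap
  · obtain ⟨t, rfl⟩ := surjective_of_add_one hG hG1 x
    have h1 : Φ.symm (G t : ℂ) = t := by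
      rw [Homeomorph.symm_apply_eq, hΦ, beurlingAhlfors_ofReal]
    have h2 : (m : ℂ) * (t : ℂ) = ((m * t : ℝ) : ℂ) := by push_cast; rfl
    rw [conjMul, h1, h2, hΦ, beurlingAhlfors_ofReal, hGF]
  set e := min 1 (η / (96 * (1 + M) ^ 2)) with he
  have he0 : 0 < e := by positivity
  have he1 : e ≤ 1 := min_le_left _ _
  have heη : 96 * (1 + M) ^ 2 * e ≤ η := by
    have := min_le_right 1 (η / (96 * (1 + M) ^ 2))
    rw [← he, le_div_iff₀ (by positivity)] at this
    linarith
  obtain ⟨d₁, hd₁, hsmall⟩ : ∃ d₁ : ℝ, 0 < d₁ ∧ ∀ y, 0 < y → y < d₁ → ε y ≤ e := by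
    have := hε.tendsto.eventually_le_const he0
    obtain ⟨d₁, hd₁, h⟩ := (mem_nhdsGT_iff_exists_Ioo_subset).1 this
    exact ⟨d₁, hd₁, fun y hy hy' => h ⟨hy, hy'⟩⟩
  -- Near the real line the interval seen by the derivative has G-image shorter than d₁, the scale
  -- at which all F⁻ⁿ are almost symmetric.
  obtain ⟨d₂, hd₂, hGd⟩ := exists_strip (u := fun z => G (z.re + |z.im|) - G (z.re - |z.im|))
    (by fun_prop) (fun z => by
      have e1 : (z + 1).re + |(z + 1).im| = z.re + |z.im| + 1 := by simp; ring
      have e2 : (z + 1).re - |(z + 1).im| = z.re - |z.im| + 1 := by simp; ring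
      simp only [e1, e2, hG1]; ring) (fun x => by simp) hd₁
  obtain ⟨d, hd, hdΦ⟩ := exists_strip (u := fun w => (Φ.symm w).im)
    (Complex.continuous_im.comp Φ.symm.continuous) (fun w => by
      have : Φ.symm (w + 1) = Φ.symm w + 1 := by
        rw [Homeomorph.symm_apply_eq, hΦ1, Homeomorph.apply_symm_apply]
      simp [this])
    (fun x => by rw [← hΦ0]; simp) hd₂
  refine ⟨d, hd, fun n hn w hw0 hwd => ?_⟩
  set z := Φ.symm w with hz
  have hzw : Φ z = w := by rw [hz, Homeomorph.apply_symm_apply]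
  have hz0 : z.im ≠ 0 := by
    intro h; rw [← hΦ0, hzw] at h; exact hw0 h
  obtain ⟨b, hb, hest⟩ := exists_norm_beurlingAhlforsDeriv_sub_le hG hGm hM0 hGqs
    (F.symm.continuous.iterate n) (hmono n) he0.le he1
    (fun x y hy hy' => hweak n hn x y e hy (hsmall y hy hy')) hz0
    ((le_abs_self _).trans_lt (hGd z (hdΦ w hwd)))
  obtain ⟨L, hL⟩ := exists_equiv_beurlingAhlforsDeriv hG hGm hM0 hGqs hz0
  have hsymm : HasFDerivAt Φ.symm (L.symm : ℂ →L[ℝ] ℂ) w := by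
    refine HasFDerivAt.of_local_left_inverse (f := Φ) (f' := L) Φ.symm.continuous.continuousAt ?_
      (Filter.Eventually.of_forall fun y => Φ.apply_symm_apply y)
    rw [hL, funext hΦ]
    exact (hasStrictFDerivAt_beurlingAhlfors hG hz0).hasFDerivAt
  have hK := (hasStrictFDerivAt_beurlingAhlfors
    (G := fun s => (F.symm^[n]) (G s)) ((F.symm.continuous.iterate n).comp hG) hz0).hasFDerivAt
  have hcomp := hK.comp w hsymm
  refine ⟨_, hcomp.congr_of_eventuallyEq (Filter.Eventually.of_forall fun w' => ?_), b,
    by exact_mod_cast hb.ne', fun v => ?_⟩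
  -- Scaling: Φ(m⁻ⁿ z) is the extension of G(m⁻ⁿ ·) = F⁻ⁿ ∘ G at z.
  · simp only [Function.comp, hGn]
    rw [beurlingAhlfors_comp_mul, conjMul, hΦ]
    push_cast
    rfl
  · have h1 := hest (L.symm v)
    -- The derivative of Φ⁻¹ cancels that of Φ, leaving multiplication by the real number b as the
    -- comparison map.
    have h2 : beurlingAhlforsDeriv G z (L.symm v) = v := by
      rw [← hL]; simp
    rw [h2] at h1
    refine h1.trans ?_
    gcongr

/-! ### The exponential covering of the punctured plane -/

/-- The universal covering `z ↦ exp (2 π i z)` of the punctured plane. -/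
def expMap (z : ℂ) : ℂ := Complex.exp (2 * Real.pi * Complex.I * z)

/-- A right inverse of `expMap` on the punctured plane. -/
def logMap (w : ℂ) : ℂ := Complex.log w / (2 * Real.pi * Complex.I)

theorem expMap_ne_zero (z : ℂ) : expMap z ≠ 0 := Complex.exp_ne_zero _

theorem expMap_logMap {w : ℂ} (hw : w ≠ 0) : expMap (logMap w) = w := by
  rw [expMap, logMap, mul_div_cancel₀ _ Complex.two_pi_I_ne_zero, Complex.exp_log hw]

theorem expMap_eq_iff {z w : ℂ} : expMap z = expMap w ↔ ∃ k : ℤ, z = w + k := by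
  rw [expMap, expMap, Complex.exp_eq_exp_iff_exists_int]
  refine exists_congr fun k => ⟨fun h => ?_, fun h => ?_⟩
  · refine mul_left_cancel₀ Complex.two_pi_I_ne_zero ?_
    rw [h]; ring
  · rw [h]; ring

theorem expMap_add_int (z : ℂ) (k : ℤ) : expMap (z + k) = expMap z :=
  expMap_eq_iff.2 ⟨k, rfl⟩

theorem hasStrictDerivAt_expMap (z : ℂ) :
    HasStrictDerivAt expMap (2 * Real.pi * Complex.I * expMap z) z := by
  have := (Complex.hasStrictDerivAt_exp (2 * Real.pi * Complex.I * z)).comp z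
    ((hasStrictDerivAt_id z).const_mul (2 * Real.pi * Complex.I))
  refine this.congr_deriv ?_
  rw [mul_one, mul_comm]
  rfl

theorem continuous_expMap : Continuous expMap := by
  unfold expMap; fun_prop

theorem map_expMap_nhds (z : ℂ) : Filter.map expMap (𝓝 z) = 𝓝 (expMap z) :=
  (hasStrictDerivAt_expMap z).map_nhds_eq (mul_ne_zero Complex.two_pi_I_ne_zero (expMap_ne_zero z))

theorem isOpenMap_expMap : IsOpenMap expMap :=
  IsOpenMap.of_nhds_le fun z => (map_expMap_nhds z).ge

theorem norm_expMap (z : ℂ) : ‖expMap z‖ = Real.exp (-(2 * Real.pi * z.im)) := by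
  rw [expMap, Complex.norm_exp]
  simp

theorem norm_expMap_eq_one_iff {z : ℂ} : ‖expMap z‖ = 1 ↔ z.im = 0 := by
  rw [norm_expMap, Real.exp_eq_one_iff]
  simp [Real.pi_ne_zero]

theorem expMap_conj (z : ℂ) :
    expMap ((starRingEnd ℂ) z) = 1 / (starRingEnd ℂ) (expMap z) := by
  rw [expMap, expMap, ← Complex.exp_conj, one_div, ← Complex.exp_neg]
  simp [Complex.conj_ofNat]

theorem coe_covering (x : ℝ) : (covering x : ℂ) = expMap x := by
  rw [covering, Circle.coe_exp, expMap]
  push_cast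
  ring_nf

theorem expMap_injOn_ball (z : ℂ) : Set.InjOn expMap (Metric.ball z (1 / 2)) := by
  intro a ha b hb hab
  obtain ⟨k, hk⟩ := expMap_eq_iff.1 hab
  have h1 : dist a b < 1 := by
    have := dist_triangle_right a b z
    rw [Metric.mem_ball] at ha hb
    linarith
  rw [hk, dist_eq_norm, add_sub_cancel_left, Complex.norm_intCast] at h1
  have : k = 0 := by
    have h2 : |k| < 1 := by exact_mod_cast h1
    exact Int.abs_lt_one_iff.1 h2
  simp [hk, this]

/-- The inner radius of the annulus which is covered by the strip `|Im z| < δ`. -/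
def radius (δ : ℝ) : ℝ := Real.exp (-(2 * Real.pi * δ))

theorem radius_pos (δ : ℝ) : 0 < radius δ := Real.exp_pos _

theorem radius_lt_one {δ : ℝ} (hδ : 0 < δ) : radius δ < 1 := by
  rw [radius, Real.exp_lt_one_iff]
  have := Real.pi_pos
  simp only [Left.neg_neg_iff]
  positivity

theorem radius_le_radius {δ δ' : ℝ} (h : δ ≤ δ') : radius δ' ≤ radius δ := by
  rw [radius, radius, Real.exp_le_exp]
  have := Real.pi_pos
  gcongr

theorem expMap_mem_annulus {z : ℂ} {δ : ℝ} : expMap z ∈ annulus (radius δ) ↔ |z.im| < δ := by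
  have hπ : 0 < 2 * Real.pi := by positivity
  rw [annulus, Set.mem_ofPred_eq, norm_expMap, radius, one_div, ← Real.exp_neg, Real.exp_lt_exp,
    Real.exp_lt_exp, neg_neg, abs_lt]
  constructor
  · rintro ⟨h1, h2⟩
    constructor <;> nlinarith
  · rintro ⟨h1, h2⟩
    constructor <;> nlinarith

theorem ne_zero_of_mem_annulus {δ : ℝ} {w : ℂ} (hw : w ∈ annulus (radius δ)) : w ≠ 0 := by
  rw [← norm_pos_iff]
  exact (radius_pos δ).trans hw.1

theorem isOpen_annulus (r : ℝ) : IsOpen (annulus r) :=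
  (isOpen_lt continuous_const continuous_norm).inter (isOpen_lt continuous_norm continuous_const)

/-- `L` is a branch of the inverse of `expMap` on `Ω`. -/
def IsLogBranch (Ω : Set ℂ) (L : ℂ → ℂ) : Prop :=
  ∀ w ∈ Ω, HasStrictDerivAt L (2 * Real.pi * Complex.I * w)⁻¹ w ∧ expMap (L w) = w

theorem IsLogBranch.add_int {Ω : Set ℂ} {L : ℂ → ℂ} (h : IsLogBranch Ω L) (k : ℤ) :
    IsLogBranch Ω (fun w => L w + k) := fun w hw =>
  ⟨(h w hw).1.add_const _, by rw [expMap_add_int, (h w hw).2]⟩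

theorem IsLogBranch.continuousOn {Ω : Set ℂ} {L : ℂ → ℂ} (h : IsLogBranch Ω L) :
    ContinuousOn L Ω := fun w hw => (h w hw).1.hasDerivAt.continuousAt.continuousWithinAt

/-- A disc that omits 0 has radius at most ‖c‖, so w/c ranges in the unit disc about 1, where the
principal logarithm is holomorphic. -/
theorem exists_isLogBranch {c : ℂ} {δ : ℝ} (hδ : 0 < δ) (h0 : (0 : ℂ) ∉ Metric.ball c δ) :
    ∃ L, IsLogBranch (Metric.ball c δ) L := by
  have hcδ : δ ≤ ‖c‖ := by
    rw [Metric.mem_ball, not_lt, dist_zero_left] at h0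
    exact h0
  have hc : c ≠ 0 := norm_pos_iff.1 (hδ.trans_le hcδ)
  refine ⟨fun w => (Complex.log (w / c) + Complex.log c) / (2 * Real.pi * Complex.I),
    fun w hw => ?_⟩
  have hw0 : w ≠ 0 := fun h => h0 (h ▸ hw)
  constructor
  · have hs : w / c ∈ Complex.slitPlane := by
      refine Complex.ball_one_subset_slitPlane ?_
      have e : w / c - 1 = (w - c) / c := by field_simp
      rw [Metric.mem_ball, dist_eq_norm, e, norm_div, div_lt_one (norm_pos_iff.2 hc),
        ← dist_eq_norm]
      exact (Metric.mem_ball.1 hw).trans_le hcδ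
    have := ((((hasStrictDerivAt_id w).div_const c).clog hs).add_const (Complex.log c)).div_const
      (2 * Real.pi * Complex.I)
    refine this.congr_deriv ?_
    have := Complex.two_pi_I_ne_zero
    simp only [id]
    field_simp
  · rw [expMap, mul_div_cancel₀ _ Complex.two_pi_I_ne_zero, Complex.exp_add,
      Complex.exp_log (div_ne_zero hw0 hc), Complex.exp_log hc, div_mul_cancel₀ _ hc]

/-! ### Quasiconformality of maps in the logarithmic coordinate -/

theorem countableOnLines_sphere : CountableOnLines (Metric.sphere (0 : ℂ) 1) := by
  have key : ∀ a : ℝ, {x : ℝ | x ^ 2 = a}.Countable := fun a => by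
    refine Set.Countable.mono (s₂ := {Real.sqrt a, -Real.sqrt a}) (fun x hx => ?_)
      (Set.toFinite _).countable
    have h0 : 0 ≤ a := by rw [← (show x ^ 2 = a from hx)]; positivity
    have h1 : x ^ 2 = Real.sqrt a ^ 2 := by rw [Real.sq_sqrt h0]; exact hx
    exact sq_eq_sq_iff_eq_or_eq_neg.1 h1
  have hn : ∀ x y : ℝ, (⟨x, y⟩ : ℂ) ∈ Metric.sphere (0 : ℂ) 1 → x ^ 2 + y ^ 2 = 1 := by
    intro x y h
    rw [mem_sphere_zero_iff_norm] at h
    have := Complex.normSq_eq_norm_sq (⟨x, y⟩ : ℂ)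
    rw [h, Complex.normSq_apply] at this
    simp only at this
    linarith
  refine ⟨fun y => (key (1 - y ^ 2)).mono fun x hx => ?_,
    fun x => (key (1 - x ^ 2)).mono fun y hy => ?_⟩
  · have := hn x y hx
    simp only [Set.mem_ofPred_eq]; linarith
  · have := hn x y hy
    simp only [Set.mem_ofPred_eq]; linarith

theorem isOpenEmbedding_restrict {Ω : Set ℂ} (hΩ : IsOpen Ω) {h : ℂ → ℂ} (hinj : Set.InjOn h Ω)
    (hmap : ∀ w ∈ Ω, Filter.map h (𝓝 w) = 𝓝 (h w)) : IsOpenEmbedding (fun w : Ω => h w) := by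
  have hv : ∀ w : Ω, Filter.map (fun w : Ω => h w) (𝓝 w) = 𝓝 (h w) := by
    intro w
    have : Filter.map ((↑) : Ω → ℂ) (𝓝 w) = 𝓝 (w : ℂ) :=
      map_nhds_subtype_coe_eq_nhds w.2 (hΩ.mem_nhds w.2)
    rw [← hmap w w.2, ← this, Filter.map_map]
    rfl
  exact IsOpenEmbedding.of_continuous_injective_isOpenMap
    (continuous_iff_continuousAt.2 fun w => (hv w).le) (Set.injOn_iff_injective.1 hinj)
    (IsOpenMap.of_nhds_le fun w => (hv w).ge)

/-- The maps `L` and `expMap` are conformal, so near conformality passes from Θ to h. The real line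
corresponds to the unit circle, which is the exceptional set. -/
theorem isQuasiconformalOn_expMap_comp {c : ℂ} {δ : ℝ} (hδ : 0 < δ) {L : ℂ → ℂ}
    (hL : IsLogBranch (Metric.ball c δ) L) (Θ : ℂ ≃ₜ ℂ) {h : ℂ → ℂ}
    (hh : ∀ w ∈ Metric.ball c δ, h w = expMap (Θ (L w))) (hinj : Set.InjOn h (Metric.ball c δ))
    {η : ℝ} (hη0 : 0 ≤ η) (hη : η ≤ 1 / 4)
    (hΘ : ∀ w ∈ Metric.ball c δ, (L w).im ≠ 0 → ∃ T, HasFDerivAt Θ T (L w) ∧ NearConformal η T) :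
    IsQuasiconformalOn (Metric.ball c δ) h ∧
      ∀ ε, 8 * η < ε → DilatationLT (Metric.ball c δ) h (1 + ε) := by
  have hw0 : ∀ w ∈ Metric.ball c δ, w ≠ 0 := fun w hw => by
    rw [← (hL w hw).2]; exact expMap_ne_zero _
  have hL0 : ∀ w ∈ Metric.ball c δ, (2 * Real.pi * Complex.I * w : ℂ)⁻¹ ≠ 0 := fun w hw =>
    inv_ne_zero (mul_ne_zero Complex.two_pi_I_ne_zero (hw0 w hw))
  have hev : ∀ w ∈ Metric.ball c δ, h =ᶠ[𝓝 w] expMap ∘ Θ ∘ L := fun w hw => by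
    filter_upwards [Metric.isOpen_ball.mem_nhds hw] with w' hw' using hh w' hw'
  refine isQuasiconformalOn_and_dilatationLT (S := Metric.sphere 0 1) Metric.isOpen_ball
    (Metric.isConnected_ball hδ) Metric.isClosed_sphere (Measure.addHaar_sphere _ _ _)
    countableOnLines_sphere
    (isOpenEmbedding_restrict Metric.isOpen_ball hinj fun w hw => ?_) hη0 hη fun w hw => ?_
  · rw [Filter.map_congr (hev w hw), hh w hw, ← Filter.map_map, ← Filter.map_map,
      (hL w hw).1.map_nhds_eq (hL0 w hw), Θ.map_nhds_eq, map_expMap_nhds]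
  · obtain ⟨hwb, hwS⟩ := hw
    rw [mem_sphere_zero_iff_norm] at hwS
    have him : (L w).im ≠ 0 := by
      rwa [ne_eq, ← norm_expMap_eq_one_iff, (hL w hwb).2]
    obtain ⟨T, hT, hTn⟩ := hΘ w hwb him
    have h1 := hT.comp w ((hL w hwb).1.hasDerivAt.hasFDerivAt.restrictScalars ℝ)
    have h2 := ((hasStrictDerivAt_expMap (Θ (L w))).hasDerivAt.hasFDerivAt.restrictScalars ℝ).comp
      w h1
    refine ⟨_, h2.congr_of_eventuallyEq (hev w hwb), hTn.mul_comp_mul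
      (mul_ne_zero Complex.two_pi_I_ne_zero (expMap_ne_zero (Θ (L w)))) (hL0 w hwb) fun v => ?_⟩
    simp [mul_comm]

/-! ### The system -/

/-- The map of the punctured plane which is covered by the multiplication by `m`, conjugated
by `Φ`. -/
def system (m : ℕ) (Φ : ℂ ≃ₜ ℂ) (w : ℂ) : ℂ := expMap (conjMul Φ m (logMap w))

section system

variable {m : ℕ} {Φ : ℂ ≃ₜ ℂ}

theorem AsymptoticallyConformal.symm_add_int (hΦ : AsymptoticallyConformal m Φ) (k : ℤ) (w : ℂ) :
    Φ.symm (w + k) = Φ.symm w + k := by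
  rw [Homeomorph.symm_apply_eq, apply_add_int hΦ.add_one, Homeomorph.apply_symm_apply]

theorem AsymptoticallyConformal.conjMul_add_int (hΦ : AsymptoticallyConformal m Φ) {c : ℂ}
    {k l : ℤ} (h : c * k = l) (w : ℂ) : conjMul Φ c (w + k) = conjMul Φ c w + l := by
  rw [conjMul, hΦ.symm_add_int, mul_add, h, apply_add_int hΦ.add_one, conjMul]

theorem AsymptoticallyConformal.symm_im_eq_zero_iff (hΦ : AsymptoticallyConformal m Φ) (w : ℂ) :
    (Φ.symm w).im = 0 ↔ w.im = 0 := by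
  rw [← hΦ.im_eq_zero_iff, Homeomorph.apply_symm_apply]

theorem AsymptoticallyConformal.conjMul_conj (hΦ : AsymptoticallyConformal m Φ) (c : ℝ) (w : ℂ) :
    conjMul Φ c ((starRingEnd ℂ) w) = (starRingEnd ℂ) (conjMul Φ c w) := by
  have : Φ.symm ((starRingEnd ℂ) w) = (starRingEnd ℂ) (Φ.symm w) := by
    rw [Homeomorph.symm_apply_eq, hΦ.conj, Homeomorph.apply_symm_apply]
  rw [conjMul, conjMul, this, ← hΦ.conj]
  simp

theorem AsymptoticallyConformal.conjMul_im_eq_zero_iff (hΦ : AsymptoticallyConformal m Φ) {c : ℝ}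
    (hc : c ≠ 0) (w : ℂ) : (conjMul Φ c w).im = 0 ↔ w.im = 0 := by
  rw [conjMul, hΦ.im_eq_zero_iff, Complex.im_ofReal_mul, mul_eq_zero, hΦ.symm_im_eq_zero_iff]
  simp [hc]

/-- The choice of logarithm, and its jump, do not matter: the conjugated multiplication by m turns
integer translations into integer translations. -/
theorem AsymptoticallyConformal.system_expMap (hΦ : AsymptoticallyConformal m Φ) (z : ℂ) :
    system m Φ (expMap z) = expMap (conjMul Φ m z) := by
  obtain ⟨k, hk⟩ := expMap_eq_iff.1 (expMap_logMap (expMap_ne_zero z))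
  rw [system, hk, hΦ.conjMul_add_int (l := m * k) (by push_cast; rfl), expMap_add_int]

theorem AsymptoticallyConformal.iterate_system_expMap (hΦ : AsymptoticallyConformal m Φ) (n : ℕ)
    (z : ℂ) : (system m Φ)^[n] (expMap z) = expMap (conjMul Φ ((m : ℂ) ^ n) z) := by
  induction n generalizing z with
  | zero => simp
  | succ n ih =>
    rw [Function.iterate_succ_apply, hΦ.system_expMap, ih, conjMul_conjMul, pow_succ]

/-- The points of the fibre of an iterate over `expMap u`. -/
theorem AsymptoticallyConformal.iterate_system_eq_iff (hΦ : AsymptoticallyConformal m Φ)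
    (hm : m ≠ 0) {n : ℕ} {ζ u : ℂ} : (system m Φ)^[n] (expMap ζ) = expMap u ↔
      ∃ k : ℤ, ζ = conjMul Φ ((m : ℂ) ^ n)⁻¹ (u + k) := by
  have hm' : ((m : ℂ) ^ n) ≠ 0 := pow_ne_zero _ (Nat.cast_ne_zero.2 hm)
  rw [hΦ.iterate_system_expMap, expMap_eq_iff]
  refine exists_congr fun k => ⟨fun h => ?_, fun h => ?_⟩
  · rw [← h, conjMul_inv_conjMul Φ hm']
  · rw [h, conjMul_conjMul_inv Φ hm']

/-- A translation by l after the conjugated division by mⁿ is a translation by mⁿ l before it, so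
the fibre is labelled by the residues modulo mⁿ. -/
theorem AsymptoticallyConformal.expMap_conjMul_inv_eq_iff (hΦ : AsymptoticallyConformal m Φ)
    (hm : m ≠ 0) {n : ℕ} {u : ℂ} {j k : ℤ} :
    expMap (conjMul Φ ((m : ℂ) ^ n)⁻¹ (u + j)) = expMap (conjMul Φ ((m : ℂ) ^ n)⁻¹ (u + k)) ↔
      ∃ l : ℤ, j = k + m ^ n * l := by
  have hm' : ((m : ℂ) ^ n) ≠ 0 := pow_ne_zero _ (Nat.cast_ne_zero.2 hm)
  have hadd : ∀ l : ℤ, conjMul Φ ((m : ℂ) ^ n)⁻¹ (u + k) + l =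
      conjMul Φ ((m : ℂ) ^ n)⁻¹ (u + (k + m ^ n * l : ℤ)) := by
    intro l
    rw [← hΦ.conjMul_add_int (k := m ^ n * l) (l := l) (by push_cast; field_simp)]
    push_cast
    rw [add_assoc]
  rw [expMap_eq_iff]
  refine exists_congr fun l => ⟨fun h => ?_, fun h => ?_⟩
  · rw [hadd] at h
    have := (conjMulHomeomorph Φ (inv_ne_zero hm')).injective h
    exact_mod_cast add_left_cancel this
  · rw [hadd, h]

/-- This is what makes an inverse branch on a connected set unique once its value at one point is
known. -/
theorem AsymptoticallyConformal.isLocallyInjective_iterate (hΦ : AsymptoticallyConformal m Φ)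
    (hm : m ≠ 0) (n : ℕ) :
    IsLocallyInjective (fun w : {w : ℂ // w ≠ 0} => (system m Φ)^[n] w) := by
  have hm' : ((m : ℂ) ^ n) ≠ 0 := pow_ne_zero _ (Nat.cast_ne_zero.2 hm)
  rintro ⟨w, hw⟩
  set ζ := logMap w with hζ
  set B := Metric.ball (conjMul Φ ((m : ℂ) ^ n) ζ) (1 / 2)
  refine ⟨Subtype.val ⁻¹' (expMap '' (conjMul Φ ((m : ℂ) ^ n) ⁻¹' B)),
    (isOpenMap_expMap _ (Metric.isOpen_ball.preimage (continuous_conjMul Φ _))).preimage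
      continuous_subtype_val, ⟨ζ, Metric.mem_ball_self (by norm_num), expMap_logMap hw⟩, ?_⟩
  rintro ⟨_, _⟩ ⟨a, ha, rfl⟩ ⟨_, _⟩ ⟨b, hb, rfl⟩ hab
  simp only [hΦ.iterate_system_expMap] at hab
  have := (conjMulHomeomorph Φ hm').injective (expMap_injOn_ball _ ha hb hab)
  simp [this]

/-- The branches of the inverses of the iterates in the logarithmic coordinate. -/
theorem AsymptoticallyConformal.exists_eq_of_isInverseBranch (hΦ : AsymptoticallyConformal m Φ)
    (hm : m ≠ 0) {δ₀ : ℝ} {n : ℕ} (hn : 1 ≤ n) {c : ℂ} {δ : ℝ} (hδ : 0 < δ) {L : ℂ → ℂ}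
    (hL : IsLogBranch (Metric.ball c δ) L) {h : ℂ → ℂ}
    (hh : IsInverseBranch (annulus (radius δ₀)) (system m Φ) n (Metric.ball c δ) h) :
    ∃ k : ℤ, ∀ w ∈ Metric.ball c δ, h w = expMap (conjMul Φ ((m : ℂ) ^ n)⁻¹ (L w + k)) := by
  -- Since n ≥ 1, the time 0 condition on the orbit already places h w in the annulus.
  have hne : ∀ w ∈ Metric.ball c δ, h w ≠ 0 := fun w hw =>
    ne_zero_of_mem_annulus (hh.mem_iterDomain w hw 0 hn)
  obtain ⟨k, hk⟩ : ∃ k : ℤ, h c = expMap (conjMul Φ ((m : ℂ) ^ n)⁻¹ (L c + k)) := by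
    have hc : c ∈ Metric.ball c δ := Metric.mem_ball_self hδ
    have h1 := hh.iterate_eq c hc
    rw [← expMap_logMap (hne c hc)] at h1
    nth_rw 2 [← (hL c hc).2] at h1
    obtain ⟨k, hk⟩ := (hΦ.iterate_system_eq_iff hm).1 h1
    exact ⟨k, by rw [← hk, expMap_logMap (hne c hc)]⟩
  refine ⟨k, ?_⟩
  have : PreconnectedSpace (Metric.ball c δ) :=
    isPreconnected_iff_preconnectedSpace.1 (Metric.isConnected_ball hδ).isPreconnected
  -- Both branches are continuous lifts of the inclusion of the disc through the iterate and agree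
  -- at the centre c.
  have heq := (T2Space.isSeparatedMap
    (fun w : {w : ℂ // w ≠ 0} => (system m Φ)^[n] w)).eq_of_comp_eq
    (hΦ.isLocallyInjective_iterate hm n) (A := Metric.ball c δ)
    (g₁ := fun w => ⟨h w, hne w w.2⟩)
    (g₂ := fun w => ⟨expMap (conjMul Φ ((m : ℂ) ^ n)⁻¹ (L w + k)), expMap_ne_zero _⟩)
    (Continuous.subtype_mk (continuousOn_iff_continuous_domRestrict.1 hh.continuousOn) _)
    (Continuous.subtype_mk (continuous_expMap.comp ((continuous_conjMul Φ _).comp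
      ((continuousOn_iff_continuous_domRestrict.1 hL.continuousOn).add continuous_const))) _)
    (by
      funext w
      have h1 := (hΦ.iterate_system_eq_iff hm (n := n) (u := L w)).2 ⟨k, rfl⟩
      rw [(hL w w.2).2] at h1
      simp only [Function.comp]
      rw [h1, hh.iterate_eq w w.2])
    ⟨c, Metric.mem_ball_self hδ⟩ (Subtype.ext hk)
  intro w hw
  exact congrArg Subtype.val (congrFun heq ⟨w, hw⟩)

theorem AsymptoticallyConformal.exists_strip_symm (hΦ : AsymptoticallyConformal m Φ) {d : ℝ}
    (hd : 0 < d) : ∃ δ : ℝ, 0 < δ ∧ ∀ w : ℂ, |w.im| < δ → |(Φ.symm w).im| < d :=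
  exists_strip (Complex.continuous_im.comp Φ.symm.continuous)
    (fun w => by simpa using congrArg Complex.im (hΦ.symm_add_int 1 w))
    (fun x => (hΦ.symm_im_eq_zero_iff x).2 (by simp)) hd

theorem AsymptoticallyConformal.exists_strip_apply (hΦ : AsymptoticallyConformal m Φ) {d : ℝ}
    (hd : 0 < d) : ∃ δ : ℝ, 0 < δ ∧ ∀ w : ℂ, |w.im| < δ → |(Φ w).im| < d :=
  exists_strip (Complex.continuous_im.comp Φ.continuous)
    (fun w => by simpa using congrArg Complex.im (hΦ.add_one w))
    (fun x => (hΦ.im_eq_zero_iff x).2 (by simp)) hd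

/-- The assumption `hu` keeps the orbits of all candidate preimages in the annulus, so none is lost,
and the residues modulo mⁿ count them. -/
theorem AsymptoticallyConformal.ncard_fibre (hΦ : AsymptoticallyConformal m Φ) (hm : m ≠ 0)
    {δ₀ : ℝ} {n : ℕ} {u : ℂ}
    (hu : ∀ k < n, ∀ j : ℤ,
      expMap (conjMul Φ ((m : ℂ) ^ k) (conjMul Φ ((m : ℂ) ^ n)⁻¹ (u + j))) ∈
        annulus (radius δ₀)) (hn : 1 ≤ n) :
    {z | z ∈ iterDomain (annulus (radius δ₀)) (system m Φ) n ∧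
      (system m Φ)^[n] z = expMap u}.ncard = m ^ n := by
  set b : ℕ → ℂ := fun j => expMap (conjMul Φ ((m : ℂ) ^ n)⁻¹ (u + (j : ℤ))) with hb
  have hinj : Set.InjOn b (Finset.range (m ^ n)) := by
    intro j hj k hk hjk
    obtain ⟨l, hl⟩ := (hΦ.expMap_conjMul_inv_eq_iff hm).1 hjk
    have h1 : (j : ℤ) ≡ k [ZMOD ((m ^ n : ℕ) : ℤ)] := by
      rw [hl]; push_cast; simp [Int.ModEq]
    have h2 := (Int.natCast_modEq_iff.1 h1)
    exact Nat.ModEq.eq_of_lt_of_lt h2 (by simpa using hj) (by simpa using hk)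
  have hset : {z | z ∈ iterDomain (annulus (radius δ₀)) (system m Φ) n ∧
      (system m Φ)^[n] z = expMap u} = b '' (Finset.range (m ^ n)) := by
    ext z
    constructor
    · rintro ⟨h1, h2⟩
      have hz : z ≠ 0 := ne_zero_of_mem_annulus (h1 0 hn)
      rw [← expMap_logMap hz] at h2
      obtain ⟨k, hk⟩ := (hΦ.iterate_system_eq_iff hm).1 h2
      have hpos : (0 : ℤ) < m ^ n := by positivity
      have h0 : 0 ≤ k % (m ^ n : ℤ) := Int.emod_nonneg _ hpos.ne'
      refine ⟨(k % (m ^ n : ℤ)).toNat, ?_, ?_⟩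
      · have := Int.emod_lt_of_pos k hpos
        simp only [Finset.coe_range, Set.mem_Iio]
        rw [Int.toNat_lt h0]
        exact_mod_cast this
      · rw [← expMap_logMap hz, hk, hb]
        simp only
        rw [hΦ.expMap_conjMul_inv_eq_iff hm, Int.toNat_of_nonneg h0]
        exact ⟨-(k / (m ^ n : ℤ)), by have := Int.emod_add_mul_ediv k (m ^ n : ℤ); linarith⟩
    · rintro ⟨j, -, rfl⟩
      refine ⟨fun k hk => ?_, (hΦ.iterate_system_eq_iff hm).2 ⟨j, rfl⟩⟩
      rw [hb]
      simp only
      rw [hΦ.iterate_system_expMap]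
      exact hu k hk j
  rw [hset, hinj.ncard_image, Set.ncard_coe_finset, Finset.card_range]

/-- The forward derivative is the inverse of the derivative of the first inverse iterate, which is
injective because η < 1. -/
theorem AsymptoticallyConformal.near_forward (hΦ : AsymptoticallyConformal m Φ) (hm : m ≠ 0)
    {η : ℝ} (hη0 : 0 < η) (hη : η ≤ 1 / 4) : ∃ d : ℝ, 0 < d ∧ ∀ w : ℂ, w.im ≠ 0 → |w.im| < d →
      ∃ T, HasFDerivAt (conjMul Φ m) T w ∧ NearConformal (2 * η) T := by
  obtain ⟨d₀, hd₀, hnear⟩ := hΦ.near η hη0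
  have hm' : (m : ℂ) ≠ 0 := Nat.cast_ne_zero.2 hm
  have him : ∀ w : ℂ, (conjMul Φ m w).im = 0 ↔ w.im = 0 := fun w => by
    simpa using hΦ.conjMul_im_eq_zero_iff (c := m) (Nat.cast_ne_zero.2 hm) w
  obtain ⟨d, hd, hdd⟩ := exists_strip (u := fun w => (conjMul Φ m w).im)
    (Complex.continuous_im.comp (continuous_conjMul Φ m))
    (fun w => by
      simpa using congrArg Complex.im (hΦ.conjMul_add_int (c := m) (k := 1) (l := m) (by simp) w))
    (fun x => (him x).2 (by simp)) hd₀
  refine ⟨d, hd, fun w hw0 hwd => ?_⟩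
  obtain ⟨T, hT, hTn⟩ := hnear 1 le_rfl (conjMul Φ m w) (mt (him w).1 hw0) (hdd w hwd)
  rw [pow_one] at hT
  have hTinj : Function.Injective T := by
    rw [injective_iff_map_eq_zero]
    intro v hv
    obtain ⟨c, hc, h⟩ := hTn
    have h1 := h v
    rw [hv, zero_sub, norm_neg, norm_mul] at h1
    by_contra hv0
    have : 0 < ‖c‖ * ‖v‖ := mul_pos (norm_pos_iff.2 hc) (norm_pos_iff.2 hv0)
    nlinarith
  set E : ℂ ≃L[ℝ] ℂ := (LinearEquiv.ofInjectiveEndo (T : ℂ →ₗ[ℝ] ℂ)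
    hTinj).toContinuousLinearEquiv with hE
  have hET : (E : ℂ →L[ℝ] ℂ) = T := rfl
  refine ⟨E.symm, HasFDerivAt.of_local_left_inverse (f := conjMul Φ (m : ℂ)⁻¹)
    (continuous_conjMul Φ m).continuousAt (by rwa [hET])
    (Filter.Eventually.of_forall fun y => conjMul_inv_conjMul Φ hm' y), ?_⟩
  refine hTn.of_rightInverse hη0.le hη fun v => ?_
  rw [← hET]
  simp

end system

theorem system_coe {m : ℕ} {Φ : ℂ ≃ₜ ℂ} (hΦ : AsymptoticallyConformal m Φ) {f : Circle → Circle}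
    {F : ℝ ≃ₜ ℝ} (hF : IsLift m f F) (hΦF : ∀ x : ℝ, conjMul Φ m x = F x) (z : Circle) :
    system m Φ z = f z := by
  obtain ⟨t, rfl⟩ := Circle.exp_surjective z
  have ht : Circle.exp t = covering (t / (2 * Real.pi)) := by
    rw [covering, mul_div_cancel₀ _ (by positivity)]
  rw [ht, coe_covering, hΦ.system_expMap, hΦF, ← coe_covering, hF.semiconj]

theorem AsymptoticallyConformal.exists_isUAC {m : ℕ} (hm : 2 ≤ m) {Φ : ℂ ≃ₜ ℂ}
    (hΦ : AsymptoticallyConformal m Φ) {f : Circle → Circle} {F : ℝ ≃ₜ ℝ} (hF : IsLift m f F)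
    (hΦF : ∀ x : ℝ, conjMul Φ m x = F x) : ∃ r, IsUAC m r (system m Φ) := by
  have hm0 : m ≠ 0 := by positivity
  have hmC : (m : ℂ) ≠ 0 := Nat.cast_ne_zero.2 hm0
  -- Inverting doubles η, so 1/8 yields 1/4, the largest value admitted by the criterion of
  -- quasiconformality.
  obtain ⟨δr, hδr, hfwd⟩ := hΦ.near_forward hm0 (η := 1 / 8) (by norm_num) (by norm_num)
  refine ⟨radius δr, radius_pos _, radius_lt_one hδr, ⟨f, ⟨F, hF⟩, system_coe hΦ hF hΦF⟩,
    fun z _ => expMap_ne_zero _, fun z hz => ?_, fun z hz => ?_, ?_, fun ε hε => ?_⟩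
  · rw [← expMap_logMap (ne_zero_of_mem_annulus hz), ← expMap_conj, hΦ.system_expMap,
      hΦ.system_expMap, ← expMap_conj]
    exact congrArg expMap (by simpa using hΦ.conjMul_conj m (logMap z))
  · have hz0 := ne_zero_of_mem_annulus hz
    obtain ⟨L, hL⟩ := exists_isLogBranch (norm_pos_iff.2 hz0) (c := z) (by simp)
    have hzb : z ∈ Metric.ball z ‖z‖ := Metric.mem_ball_self (norm_pos_iff.2 hz0)
    have hcont : ContinuousAt (fun w => conjMul Φ m (L w)) z :=
      (continuous_conjMul Φ m).continuousAt.comp (hL z hzb).1.hasDerivAt.continuousAt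
    -- The lifted image is confined to a disc of radius 1/2, on which `expMap` is injective; hence
    -- the system is injective on the small disc.
    have hnhds : annulus (radius δr) ∩ (Metric.ball z ‖z‖ ∩
        (fun w => conjMul Φ m (L w)) ⁻¹' Metric.ball (conjMul Φ m (L z)) (1 / 2)) ∈ 𝓝 z :=
      Filter.inter_mem ((isOpen_annulus _).mem_nhds hz) (Filter.inter_mem
        (Metric.isOpen_ball.mem_nhds hzb)
        (hcont.preimage_mem_nhds (Metric.ball_mem_nhds _ (by norm_num))))
    obtain ⟨δ, hδ, hsub⟩ := Metric.mem_nhds_iff.1 hnhds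
    have hL' : IsLogBranch (Metric.ball z δ) L := fun w hw => hL w (hsub hw).2.1
    have hsys : ∀ w ∈ Metric.ball z δ, system m Φ w = expMap (conjMul Φ m (L w)) := fun w hw => by
      rw [← hΦ.system_expMap, (hL' w hw).2]
    refine ⟨Metric.ball z δ, Metric.mem_ball_self hδ, fun w hw => (hsub hw).1,
      (isQuasiconformalOn_expMap_comp hδ hL' (conjMulHomeomorph Φ hmC) hsys ?_ (η := 1 / 4)
        (by norm_num) le_rfl fun w hw hw0 => ?_).1⟩
    · intro a ha b hb hab
      rw [hsys a ha, hsys b hb] at hab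
      have h1 := (conjMulHomeomorph Φ hmC).injective
        (expMap_injOn_ball _ (hsub ha).2.2 (hsub hb).2.2 hab)
      rw [← (hL' a ha).2, h1, (hL' b hb).2]
    · have hwd : |(L w).im| < δr := by
        rw [← expMap_mem_annulus, (hL' w hw).2]; exact (hsub hw).1
      obtain ⟨T, hT, hTn⟩ := hfwd (L w) hw0 hwd
      exact ⟨T, hT, hTn.mono (by norm_num)⟩
  -- In the coordinate Φ the intermediate points of an orbit are m^(k-n) times the endpoint, so
  -- their imaginary parts only shrink. One strip therefore serves for all n.
  · obtain ⟨d, hd, hd'⟩ := hΦ.exists_strip_apply hδr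
    obtain ⟨δ, hδ, hδ'⟩ := hΦ.exists_strip_symm hd
    refine ⟨radius (min δ δr), radius_le_radius (min_le_right _ _),
      radius_lt_one (lt_min hδ hδr), fun n hn w hw => ?_⟩
    have he := expMap_logMap (ne_zero_of_mem_annulus hw)
    rw [← he, expMap_mem_annulus] at hw
    rw [← he]
    refine hΦ.ncard_fibre hm0 (fun k hk j => ?_) hn
    rw [expMap_mem_annulus, conjMul_conjMul]
    refine hd' _ ?_
    have h1 : |(Φ.symm (logMap w + j)).im| < d := by
      refine hδ' _ ?_
      simpa using hw.trans_le (min_le_left _ _)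
    have e : ((m : ℂ) ^ k * ((m : ℂ) ^ n)⁻¹) = (((m : ℝ) ^ k * ((m : ℝ) ^ n)⁻¹ : ℝ) : ℂ) := by
      push_cast; rfl
    rw [e, Complex.im_ofReal_mul, abs_mul]
    have h2 : |(m : ℝ) ^ k * ((m : ℝ) ^ n)⁻¹| ≤ 1 := by
      rw [abs_of_nonneg (by positivity), ← div_eq_mul_inv, div_le_one (by positivity)]
      exact pow_le_pow_right₀ (by exact_mod_cast (by omega : 1 ≤ m)) hk.le
    nlinarith [abs_nonneg (Φ.symm (logMap w + j)).im]
  -- The criterion requires η ≤ 1/4 and 8η < ε; the choice ε/16 leaves 8η ≤ ε/2.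
  · have hη : 0 < min (1 / 4) (ε / 16) := by positivity
    obtain ⟨d, hd, hnear⟩ := hΦ.near _ hη
    refine ⟨radius (min d δr), radius_le_radius (min_le_right _ _),
      radius_lt_one (lt_min hd hδr), fun n hn c δ hδ hball h hh => ?_⟩
    obtain ⟨L, hL⟩ := exists_isLogBranch hδ (fun h0 => ne_zero_of_mem_annulus (hball h0) rfl)
    obtain ⟨k, hk⟩ := hΦ.exists_eq_of_isInverseBranch hm0 hn hδ hL hh
    have hLk := hL.add_int k
    have hinj : Set.InjOn h (Metric.ball c δ) := fun a ha b hb hab => by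
      rw [← hh.iterate_eq a ha, hab, hh.iterate_eq b hb]
    have := isQuasiconformalOn_expMap_comp hδ hLk
      (conjMulHomeomorph Φ (inv_ne_zero (pow_ne_zero n hmC))) hk hinj hη.le (min_le_left _ _)
      (fun w hw hw0 => hnear n hn _ hw0 (by
        have h1 := hball hw
        rw [← (hLk w hw).2, expMap_mem_annulus] at h1
        exact h1.trans_le (min_le_left _ _)))
    exact ⟨this.1, this.2 ε (by linarith [min_le_right (1 / 4) (ε / 16)])⟩

end CircleEndo

end

theorem theorem4 (m : ℕ) (hm : 2 ≤ m) (f : Circle → Circle) (hf : CircleEndo.IsUAA m f) :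
    ∃ (r : ℝ) (g : ℂ → ℂ), CircleEndo.IsUAC m r g ∧ ∀ z : Circle, g (z : ℂ) = (f z : ℂ) := by
  obtain ⟨F, hF, ε, hε, hrho⟩ := hf
  obtain ⟨Φ, hΦ, hΦF⟩ := CircleEndo.exists_asymptoticallyConformal hm hF hε hrho
  obtain ⟨r, hr⟩ := hΦ.exists_isUAC hm hF hΦF
  exact ⟨r, CircleEndo.system m Φ, hr, CircleEndo.system_coe hΦ hF hΦF⟩
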